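/- **Setting.** A trivalent Wilson graph $\Gamma$ is a finite connected graph (multiple edges and loops allowed), all of whose vertices have valence $3$, with a distinguished oriented cycle $W_\Gamma$ (the Wilson line). Vertices on $W_\Gamma$ are called external; there are $n\ge 1$ of them, numbered $1,\dots,n$ in their order along $W_\Gamma$. The other $t$ vertices are internal. Let $E$ be the set of edges not in $W_\Gamma$, so that $2|E|=n+3t$. Put $\deg\Gamma=(n+t)/2$, and call $\Gamma$ primitive if $\Gamma-W_\Gamma$ (remove the edges of $W_\Gamma$, keep the vertices) is connected. Fix an orientation of every $e\in E$, written $\partial e=(u,v)$ for $e$ running from $u$ to $v$, and a vertex orientation, i.e. at each internal vertex $v$ a numbering $o_v$ by $1,2,3$ of the edge ends arriving there. Let $S_{n,t}$ be the set of $(a,\eta_1,\dots,\eta_n,\omega_1,\dots,\omega_t)\in S^2\times\mathbb R^n\times(\mathbb R^3)^t$ such that $\eta_1<\dots<\eta_n$ up to a cyclic permutation, $\omega_i\ne\omega_j$ for $i\neq j$, $\eta_i a\neq\omega_j$ for all $i,j$, $\sum_i\eta_i^2+\sum_j|\omega_j|^2=1$ and $\sum_i\eta_i+\sum_j\langle\omega_j,a\rangle=0$.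 It is a manifold of dimension $n+3t$. Attach to the external vertex $i$ the point $x_i=\eta_i a\in\mathbb R^3$ and to the internal vertex $j$ the point $x_j=\omega_j$. For $e\in E$ with $\partial e=(u,v)$, $u\neq v$, let $$\phi_e=\frac{x_v-x_u}{|x_v-x_u|}:S_{n,t}\to S^2,\qquad \Theta_e=\phi_e^*\omega,\qquad \omega=\tfrac1{4\pi}\left(x^1dx^2\wedge dx^3+x^2dx^3\wedge dx^1+x^3dx^1\wedge dx^2\right),$$ and $\Theta_e=0$ if $e$ is a loop. Put $\Theta_\Gamma=\prod_{e\in E}\Theta_e$, a form of degree $n+3t$. Let $\Omega(\Gamma)=\bigwedge_{e\in E}\left(dX_v^{o_v(e)}\wedge dX_u^{o_u(e)}\right)$, where $\partial e=(u,v)$, and where $dX_i=d\eta_i$ at an external vertex $i$ and $dX_j^k=d\omega_j^k$ at an internal vertex $j$. Orient $S_{n,t}$ by the form $\mathrm{vol}_{S^2}(a)\wedge\iota_T\iota_D\,\Omega(\Gamma)$, where $D=\sum_i\eta_i\partial_{\eta_i}+\sum_j\langle\omega_j,\partial_{\omega_j}\rangle$ and $T=\sum_i\partial_{\eta_i}+\sum_j\langle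 a,\partial_{\omega_j}\rangle$. The anomaly coefficient is $$f_\Gamma=\int_{S_{n,t}}\Theta_\Gamma .$$ **Theorem.** Let $\Gamma$ be a trivalent Wilson graph, with an orientation of the edges in $E$ and a vertex orientation. (i) If $\Gamma$ is not primitive, then the integral $f_\Gamma$ converges absolutely and $f_\Gamma=0$. (ii) If $\Gamma$ is primitive and $\deg\Gamma$ is even, then the integral $f_\Gamma$ converges absolutely and $f_\Gamma=0$. -/

import Mathlib

open MeasureTheory

noncomputable section

/-- A Wilson graph with external vertices `O`, internal vertices `I` and non-Wilson edges `E`.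
The Wilson line is the oriented cycle through all the external vertices; it is given by the
successor permutation `next`, its edges being the `v ⟶ next v`.  A non-Wilson edge `e`, oriented,
has boundary `(bd e 0, bd e 1)`; multiple edges and loops are allowed. -/
structure WilsonGraph (O I E : Type*) where
  next : Equiv.Perm O
  nonempty : Nonempty O
  isCycleOn : next.IsCycleOn Set.univ
  bd : E → Fin 2 → O ⊕ I
  /-- The whole graph, Wilson line included, is connected. -/
  connected : (SimpleGraph.fromRel fun x y : O ⊕ I =>
    (∃ e, bd e 0 = x ∧ bd e 1 = y) ∨ ∃ v, x = Sum.inl v ∧ y = Sum.inl (next v)).Connected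

namespace WilsonGraph

variable {O I E : Type*}

/-- The number of ends of non-Wilson edges arriving at a vertex. -/
def innerValence (G : WilsonGraph O I E) (x : O ⊕ I) : ℕ :=
  {h : E × Fin 2 | G.bd h.1 h.2 = x}.ncard

/-- The valence of a vertex: an external vertex also carries two ends of Wilson edges. -/
def valence (G : WilsonGraph O I E) : O ⊕ I → ℕ
  | Sum.inl v => G.innerValence (Sum.inl v) + 2
  | Sum.inr j => G.innerValence (Sum.inr j)

/-- All vertices have valence three. -/
def IsTrivalent (G : WilsonGraph O I E) : Prop := ∀ x, G.valence x = 3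

/-- The graph `Γ - W_Γ`: the edges of the Wilson line are removed (the vertices are kept). -/
def minusWilson (G : WilsonGraph O I E) : SimpleGraph (O ⊕ I) :=
  SimpleGraph.fromRel fun x y => ∃ e, G.bd e 0 = x ∧ G.bd e 1 = y

/-- `Γ` is primitive if `Γ - W_Γ` is connected. -/
def IsPrimitive (G : WilsonGraph O I E) : Prop := G.minusWilson.Connected

/-- The degree `(n + t) / 2`; for a trivalent graph `n + t` is even. -/
def deg [Fintype O] [Fintype I] (_ : WilsonGraph O I E) : ℕ :=
  (Fintype.card O + Fintype.card I) / 2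

/-- A vertex orientation of a trivalent Wilson graph: a numbering, at each internal vertex, of the
three edge ends arriving there.  (An external vertex has one edge end, with the only numbering;
`label` is not used there.) -/
structure VOrientation (G : WilsonGraph O I E) where
  label : E × Fin 2 → Fin 3
  bijOn : ∀ j : I, Set.BijOn label {h | G.bd h.1 h.2 = Sum.inr j} Set.univ

end WilsonGraph

/-- The Euclidean space `ℝ³ × ℝⁿ × (ℝ³)ᵗ`, with points `(a, η, ω)`. -/
abbrev AnomalySpace (O I : Type*) : Type _ := EuclideanSpace ℝ (Fin 3 ⊕ (O ⊕ I × Fin 3))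

namespace AnomalySpace

variable {O I : Type*}

/-- The component `a`. -/
def a (p : AnomalySpace O I) : EuclideanSpace ℝ (Fin 3) :=
  WithLp.toLp 2 fun k => p (Sum.inl k)

/-- The components `η`. -/
def eta (p : AnomalySpace O I) (i : O) : ℝ := p (Sum.inr (Sum.inl i))

/-- The components `ω`. -/
def om (p : AnomalySpace O I) (j : I) : EuclideanSpace ℝ (Fin 3) :=
  WithLp.toLp 2 fun k => p (Sum.inr (Sum.inr (j, k)))

/-- The point of `ℝ³` at which a vertex is placed: `a · η_i` or `ω_j`. -/
def pos (p : AnomalySpace O I) : O ⊕ I → EuclideanSpace ℝ (Fin 3)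
  | Sum.inl i => p.eta i • p.a
  | Sum.inr j => p.om j

/-- The vector `(a, 0, 0)` at the point `(a, η, ω)`. -/
def radial (p : AnomalySpace O I) : AnomalySpace O I :=
  WithLp.toLp 2 (Sum.elim (fun k => p.a k) fun _ => 0)

/-- The dilatation vector `(0, η, ω)` at the point `(a, η, ω)`. -/
def dilatation (p : AnomalySpace O I) : AnomalySpace O I :=
  WithLp.toLp 2 (Sum.elim (fun _ => 0) (Sum.elim (fun i => p.eta i) fun jk => p.om jk.1 jk.2))

/-- The translation vector along `a`: `(0, (1, …, 1), (a, …, a))` at the point `(a, η, ω)`. -/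
def translation (p : AnomalySpace O I) : AnomalySpace O I :=
  WithLp.toLp 2 (Sum.elim (fun _ => 0) (Sum.elim (fun _ => 1) fun jk => p.a jk.2))

/-- `v` is tangent at `p` to the submanifold given by `|a|² = 1`, `∑ η_i² + ∑ |ω_j|² = 1` and
`∑ η_i + ∑ ⟨ω_j, a⟩ = 0`: the differentials of the three equations vanish on `v`. -/
def IsTangent [Fintype O] [Fintype I] (p v : AnomalySpace O I) : Prop :=
  inner ℝ p.a v.a = 0 ∧
  ∑ i, p.eta i * v.eta i + ∑ j, inner ℝ (p.om j) (v.om j) = 0 ∧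
  ∑ i, v.eta i + ∑ j, (inner ℝ (v.om j) p.a + inner ℝ (p.om j) v.a) = 0

end AnomalySpace

/-- `u(x) = x / |x|`. -/
def unitVector (x : EuclideanSpace ℝ (Fin 3)) : EuclideanSpace ℝ (Fin 3) := ‖x‖⁻¹ • x

/-- The Gauss two-form
`(1 / 4π) (x¹ dx² ∧ dx³ + x³ dx¹ ∧ dx² + x² dx³ ∧ dx¹)` at `x`, evaluated on `(y, z)`. -/
def gaussForm (x y z : EuclideanSpace ℝ (Fin 3)) : ℝ :=
  (1 / (4 * Real.pi)) * (x 0 * (y 1 * z 2 - y 2 * z 1) + x 2 * (y 0 * z 1 - y 1 * z 0)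
    + x 1 * (y 2 * z 0 - y 0 * z 2))

/-- The wedge product of a family of alternating two-forms `α e`, evaluated on a family of vectors
`v` indexed by `E × Fin 2`.  Two-forms commute, so the edges need no ordering; for any ordering
`e₁, e₂, …` of `E`, the vectors are taken in the order `v (e₁, 0), v (e₁, 1), v (e₂, 0), …`. -/
def wedgeTwoForms {E W : Type*} [Fintype E] [DecidableEq E] (α : E → W → W → ℝ)
    (v : E × Fin 2 → W) : ℝ :=
  (1 / 2 ^ Fintype.card E) * ∑ σ : Equiv.Perm (E × Fin 2),
    ((Equiv.Perm.sign σ : ℤ) : ℝ) * ∏ e, α e (v (σ (e, 0))) (v (σ (e, 1)))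

namespace WilsonGraph

variable {O I E : Type*} [Fintype O] [Fintype I] [Fintype E]

/-- The variety `S_{n,t}`, its coordinates being indexed by the vertices of the graph. In the
condition `η_1 < ⋯ < η_n`, up to cyclic permutation, the external vertices are numbered in
their order along the Wilson line. -/
def anomalyVariety (G : WilsonGraph O I E) : Set (AnomalySpace O I) :=
  {p | ‖p.a‖ = 1 ∧
    (∃ v : O, ∀ k l : ℕ, k < l → l < Fintype.card O →
      p.eta ((G.next ^ k) v) < p.eta ((G.next ^ l) v)) ∧
    (∀ i j : I, i ≠ j → p.om i ≠ p.om j) ∧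
    (∀ (i : O) (j : I), p.eta i • p.a ≠ p.om j) ∧
    ∑ i, p.eta i ^ 2 + ∑ j, ‖p.om j‖ ^ 2 = 1 ∧
    ∑ i, p.eta i + ∑ j, inner ℝ (p.om j) p.a = 0}

/-- The map `φ_e`, with values in `S²`: the direction from the origin to the end of the oriented
edge `e`.  (For a loop it is the constant `0`, so that its pullback form is `0`, which is the
convention for loops.) -/
def gaussMap (G : WilsonGraph O I E) (e : E) (p : AnomalySpace O I) : EuclideanSpace ℝ (Fin 3) :=
  unitVector (p.pos (G.bd e 1) - p.pos (G.bd e 0))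

/-- The form `Θ_e = φ_e^* ω` at `p`. -/
def edgeForm (G : WilsonGraph O I E) (p : AnomalySpace O I) (e : E) (v w : AnomalySpace O I) : ℝ :=
  gaussForm (G.gaussMap e p) (fderiv ℝ (G.gaussMap e) p v) (fderiv ℝ (G.gaussMap e) p w)

/-- The form `Θ_Γ = ∏_e Θ_e` at `p`. It has degree `2 |E| = n + 3 t`. -/
def anomalyForm [DecidableEq E] (G : WilsonGraph O I E) (p : AnomalySpace O I)
    (v : E × Fin 2 → AnomalySpace O I) : ℝ :=
  wedgeTwoForms (G.edgeForm p) v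

/-- The covector `dX_v^{o_v(e)}` attached to an edge end `h` at the vertex `v`: it is `dη_v` at an
external vertex, and one of the three components of `dω_v`, selected by the vertex orientation, at
an internal vertex. -/
def endCovector (G : WilsonGraph O I E) (o : G.VOrientation) (h : E × Fin 2)
    (v : AnomalySpace O I) : ℝ :=
  match G.bd h.1 h.2 with
  | Sum.inl i => v.eta i
  | Sum.inr j => v.om j (o.label h)

/-- The form giving the orientation of `S_{n,t}` induced by
`Ω(Γ, or) = ⋀_e (dX_v^{o_v(e)} ∧ dX_u^{o_u(e)})`, where `∂e = (u, v)`.  It is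
`vol_{S²}(a) ∧ ι_T ι_D Ω(Γ, or)`, with `D` the dilatation and `T` the translation along `a`; that
is, the contraction of `da¹ ∧ da² ∧ da³ ∧ Ω(Γ, or)` with the vectors `(a, 0, 0)`, `D`, `T`, in
this order. A wedge of covectors is a determinant. -/
def orientationForm [DecidableEq E] (G : WilsonGraph O I E) (o : G.VOrientation)
    (p : AnomalySpace O I) (v : E × Fin 2 → AnomalySpace O I) : ℝ :=
  Matrix.det (Matrix.of fun r c : Fin 3 ⊕ E × Fin 2 =>
    (Sum.elim (fun k (w : AnomalySpace O I) => w.a k)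
      (fun h w => G.endCovector o (h.1, h.2.rev) w) r)
    (Sum.elim ![p.radial, p.dilatation, p.translation] v c))

/-- `v` is a positively oriented orthonormal basis of the tangent space of `S_{n,t}` at `p`
(whose dimension `n + 3 t` is the number of vectors in `v`). -/
def IsPositiveFrame [DecidableEq E] (G : WilsonGraph O I E) (o : G.VOrientation)
    (p : AnomalySpace O I) (v : E × Fin 2 → AnomalySpace O I) : Prop :=
  Orthonormal ℝ v ∧ (∀ h, p.IsTangent (v h)) ∧ 0 < G.orientationForm o p v

open Classical in
/-- The density of `Θ_Γ` with respect to the Riemannian volume of the oriented manifold `S_{n,t}`: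
the value of `Θ_Γ` on a positively oriented orthonormal frame (on any one of them). -/
def anomalyDensity (G : WilsonGraph O I E) (o : G.VOrientation) (p : AnomalySpace O I) : ℝ :=
  if hv : ∃ v, G.IsPositiveFrame o p v then G.anomalyForm p hv.choose else 0

/-- The Riemannian volume of `S_{n,t}`, a submanifold of dimension `n + 3 t` of Euclidean space. -/
def anomalyVolume (G : WilsonGraph O I E) : Measure (AnomalySpace O I) :=
  (Measure.euclideanHausdorffMeasure (Fintype.card O + 3 * Fintype.card I)).restrict
    G.anomalyVariety

/-- The integral `∫ Θ_Γ` over `S_{n,t}` is absolutely convergent. -/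
def AnomalyConverges (G : WilsonGraph O I E) (o : G.VOrientation) : Prop :=
  Integrable (G.anomalyDensity o) G.anomalyVolume

/-- The anomaly coefficient `f_Γ = ∫ Θ_Γ` over the oriented manifold `S_{n,t}`. -/
def anomalyCoefficient (G : WilsonGraph O I E) (o : G.VOrientation) : ℝ :=
  ∫ p, G.anomalyDensity o p ∂G.anomalyVolume

end WilsonGraph

end

/-!
Only graphs without loops matter, since the form of a loop is zero. Everything rests on one formula
for the density of `Θ_Γ`, `WilsonGraph.anomalyDensity_eq`. Where the `k e`-th coordinate of the
vector along each edge `e` does not vanish, the Gauss map of `e` may be replaced by the pair of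
*slopes*, the quotients of the two other coordinates by that one; the form of `e` is then a nonzero
factor times the wedge product of the differentials of the two slopes, and `Θ_Γ` is the Jacobian of
the *slope map* `S_{n,t} → ℝ^(E × Fin 2)` times the product of these factors.

*Absolute convergence* (`WilsonGraph.anomalyConverges_of_forall_bd_ne`). For a suitable choice of
`k`, all slopes lie in `[-1, 1]`. The factors are bounded there, so it is enough to bound the
integral of the absolute Jacobian of the slope map, and no compactification of configuration space
is needed: by the area inequality (`exists_nhds_injOn_euclideanHausdorffMeasure_le`,
`lintegral_le_of_fibre_card_le`) the integral is at most a constant times the volume of the cube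
times a bound for the number of points in almost every fibre. Such a bound comes from algebra. The
equations of `S_{n,t}` normalise `|a|`, the scale and the position along the Wilson line, and a
group `AnomalySpace.move` that leaves the slopes unchanged can give these three any other values. So
there are `m + 3` rational functions, namely the `m = n + 3 t` slopes and three polynomials that
separate the points of each orbit, on a space with `m + 3` coordinates. Each coordinate is therefore
algebraically dependent on these functions, and outside the null set of slopes where the leading
coefficient of a relation vanishes, the degrees of the relations bound the fibre
(`exists_ae_fibre_card_le`, `WilsonGraph.exists_ae_slopeMap_fibre_card_le`).

*Non-primitive graphs.* If `Γ - W_Γ` is disconnected, the points of one component can be translated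
along the Wilson line while the others stay. No Gauss map notices, so the density vanishes
identically (`WilsonGraph.exists_isTangent_slopeForm_eq_zero`,
`WilsonGraph.anomalyDensity_eq_zero_of_not_isPrimitive`).

*Even degree.* The isometry `(a, η, ω) ↦ (-a, η, -ω)` of `S_{n,t}` moves each point to its opposite.
It changes the sign of each of the `|E|` edge forms, and multiplies the orientation by
`(-1) ^ (3 + 3 * t)` (`WilsonGraph.anomalyDensity_reflect`). As `|E| + 3 + 3 * t` is odd when the
degree is even, the integral is equal to its negative.
-/

noncomputable section

/-! ### The area inequality -/

open Set Filter Topology ENNReal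

/-- If a map `F` into `ℝ^ι` restricts to a local diffeomorphism at `p` of the level set `S` of `g`,
its Jacobian there being `det M`, then near `p` the map `F` is injective on `S` and the Hausdorff
measure of subsets of `S` is bounded by `2 ^ |ι| / |det M|` times the volume of their image. -/
theorem exists_nhds_injOn_euclideanHausdorffMeasure_le {ι V Z : Type*} [Fintype ι] [DecidableEq ι]
    [NormedAddCommGroup V] [InnerProductSpace ℝ V] [FiniteDimensional ℝ V] [MeasurableSpace V]
    [BorelSpace V] [NormedAddCommGroup Z] [NormedSpace ℝ Z] [FiniteDimensional ℝ Z]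
    {S : Set V} {F : V → EuclideanSpace ℝ ι} {g : V → Z} {p : V}
    {F' : V →L[ℝ] EuclideanSpace ℝ ι} {g' : V →L[ℝ] Z}
    (hF : HasStrictFDerivAt F F' p) (hg : HasStrictFDerivAt g g' p)
    (hgS : ∀ x ∈ S, ∀ y ∈ S, g x = g y) (hsurj : Function.Surjective g')
    {v : ι → V} (hv : Orthonormal ℝ v)
    (hspan : ∀ w, g' w = 0 → w ∈ Submodule.span ℝ (range v))
    (hdet : (Matrix.of fun r c => F' (v c) r).det ≠ 0) :
    ∃ U ∈ 𝓝 p, InjOn F (S ∩ U) ∧ ∀ B ⊆ S ∩ U,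
      Measure.euclideanHausdorffMeasure (Fintype.card ι) B ≤
        2 ^ Fintype.card ι * (ENNReal.ofReal |(Matrix.of fun r c => F' (v c) r).det|⁻¹ *
          volume (F '' B)) := by
  set M : Matrix ι ι ℝ := Matrix.of fun r c => F' (v c) r with hM
  let Mi : EuclideanSpace ℝ ι →ₗ[ℝ] EuclideanSpace ℝ ι := Matrix.toLpLin 2 2 M⁻¹
  -- the isometric parametrization of the tangent space by the frame `v`
  let A : EuclideanSpace ℝ ι →ₗ[ℝ] V :=
    { toFun := fun y => ∑ i, y i • v i
      map_add' := fun x y => by simp [add_smul, Finset.sum_add_distrib]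
      map_smul' := fun c x => by simp [Finset.smul_sum, mul_smul] }
  have hA : ∀ y, ‖A y‖ = ‖y‖ := by
    intro y
    have : ‖A y‖ ^ 2 = ‖y‖ ^ 2 := by
      rw [← real_inner_self_eq_norm_sq, EuclideanSpace.norm_sq_eq]
      simp only [A, LinearMap.coe_mk, AddHom.coe_mk, hv.inner_sum]
      simp [sq]
    exact (sq_eq_sq₀ (norm_nonneg _) (norm_nonneg _)).1 this
  have hFA : ∀ y, Mi (F' (A y)) = y := by
    intro y
    have h1 : F' (A y) = Matrix.toLpLin 2 2 M y := by
      ext r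
      simp [A, hM, Matrix.toLpLin_apply, Matrix.mulVec, dotProduct, mul_comm]
    rw [h1, ← LinearMap.comp_apply, ← Matrix.toLpLin_mul_same,
      Matrix.nonsing_inv_mul _ (isUnit_iff_ne_zero.2 hdet)]
    simp
  have hker : ∀ w, g' w = 0 → A (Mi (F' w)) = w := by
    intro w hw
    obtain ⟨c, rfl⟩ := (Submodule.mem_span_range_iff_exists_fun ℝ).1 (hspan w hw)
    have : ∑ i, c i • v i = A (WithLp.toLp 2 c) := rfl
    rw [this, hFA]
  obtain ⟨r, hr⟩ := (g' : V →ₗ[ℝ] Z).exists_rightInverse_of_surjective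
    (LinearMap.range_eq_top.2 hsurj)
  have hr' : ∀ z, g' (r z) = z := fun z => by simpa using LinearMap.congr_fun hr z
  let Ac := LinearMap.toContinuousLinearMap (A ∘ₗ Mi)
  let h := LinearMap.toContinuousLinearMap ((LinearMap.id - A ∘ₗ Mi ∘ₗ (F' : V →ₗ[ℝ] _)) ∘ₗ r)
  have hid : (Ac ∘L F' + h ∘L g') = ContinuousLinearMap.id ℝ V := by
    ext w
    have h1 := hker (w - r (g' w)) (by simp [hr'])
    simp only [map_sub] at h1
    have : A (Mi (F' w)) + (r (g' w) - A (Mi (F' (r (g' w))))) = w := by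
      rw [← sub_eq_zero, ← sub_eq_zero.2 h1]; abel
    simpa [Ac, h] using this
  -- adding a function of `g`, constant on `S`, makes the derivative the identity
  have hH : HasStrictFDerivAt (fun x => Ac (F x) + h (g x)) (ContinuousLinearMap.id ℝ V) p := by
    rw [← hid]
    exact (Ac.hasStrictFDerivAt.comp p hF).add (h.hasStrictFDerivAt.comp p hg)
  obtain ⟨U, hU, hUa⟩ := hH.approximates_deriv_on_nhds (c := 1 / 2) (Or.inr (by norm_num))
  have key : ∀ x ∈ S ∩ U, ∀ y ∈ S ∩ U, dist x y ≤ 2 * dist (Mi (F x)) (Mi (F y)) := by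
    intro x hx y hy
    have h1 := hUa x hx.2 y hy.2
    simp only [hgS x hx.1 y hy.1, add_sub_add_right_eq_sub, ContinuousLinearMap.coe_id',
      id_eq] at h1
    have h2 : ‖Ac (F x) - Ac (F y)‖ = dist (Mi (F x)) (Mi (F y)) := by
      simp only [Ac, LinearMap.coe_toContinuousLinearMap', LinearMap.comp_apply, ← map_sub, hA,
        dist_eq_norm]
    have h3 := norm_sub_norm_le (x - y) (Ac (F x) - Ac (F y))
    rw [norm_sub_rev (x - y)] at h3
    rw [dist_eq_norm, ← h2]
    have : ((1 / 2 : NNReal) : ℝ) = 1 / 2 := by norm_num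
    rw [this] at h1
    linarith
  refine ⟨U, hU, fun x hx y hy hxy => ?_, fun B hB => ?_⟩
  · have := key x hx y hy
    rw [hxy, dist_self, mul_zero] at this
    exact dist_le_zero.1 this
  · have hinj : InjOn (fun x => Mi (F x)) B := fun x hx y hy hxy => by
      have := key x (hB hx) y (hB hy)
      rw [show Mi (F x) = Mi (F y) from hxy, dist_self, mul_zero] at this
      exact dist_le_zero.1 this
    have hlip : LipschitzOnWith 2 (Function.invFunOn (fun x => Mi (F x)) B)
        ((fun x => Mi (F x)) '' B) := by
      apply LipschitzOnWith.of_dist_le_mul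
      rintro _ ⟨x, hx, rfl⟩ _ ⟨y, hy, rfl⟩
      have e1 := hinj.leftInvOn_invFunOn hx
      have e2 := hinj.leftInvOn_invFunOn hy
      rw [e1, e2]
      exact key x (hB hx) y (hB hy)
    have h1 := hlip.hausdorffMeasure_image_le (d := (Fintype.card ι : ℕ)) (by positivity)
    rw [hinj.leftInvOn_invFunOn.image_image] at h1
    have h2 : Measure.euclideanHausdorffMeasure (Fintype.card ι) B ≤ 2 ^ Fintype.card ι *
        Measure.euclideanHausdorffMeasure (Fintype.card ι) ((fun x => Mi (F x)) '' B) := by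
      simp only [Measure.euclideanHausdorffMeasure_def, Measure.smul_apply]
      rw [ENNReal.smul_def, ENNReal.smul_def, smul_eq_mul, smul_eq_mul, mul_left_comm]
      gcongr
      simpa using h1
    refine h2.trans ?_
    gcongr
    have h3 : (Measure.euclideanHausdorffMeasure (Fintype.card ι) : Measure (EuclideanSpace ℝ ι))
        = volume := by
      rw [← finrank_euclideanSpace (𝕜 := ℝ) (ι := ι)]
      exact InnerProductSpace.euclideanHausdorffMeasure_eq_volume
    rw [h3, ← image_image Mi F, Measure.addHaar_image_linearMap, LinearMap.det_toLpLin,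
      Matrix.det_nonsing_inv, Ring.inverse_eq_inv, abs_inv]

/-- If a density `J` on `S` is, locally where it does not vanish, dominated by the volume of the
image under a map `F` whose fibres almost all have at most `D` points in `S`, then its integral is
bounded by the volume of the image, counted `D` times. -/
theorem lintegral_le_of_fibre_card_le {V Y : Type*} [TopologicalSpace V] [PolishSpace V]
    [MeasurableSpace V] [BorelSpace V] [MeasurableSpace Y] [TopologicalSpace Y] [T2Space Y]
    [OpensMeasurableSpace Y] {μ : Measure V} {ν : Measure Y} {S : Set V} {J : V → ℝ≥0∞}
    {F : V → Y} {C : ℝ≥0∞} {D : ℕ} {K : Set Y} (hJS : MeasurableSet {x | x ∈ S ∧ J x ≠ 0})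
    (hS : MeasurableSet S) (hF : ContinuousOn F S)
    (hloc : ∀ p ∈ S, J p ≠ 0 → ∃ U ∈ 𝓝 p, InjOn F (S ∩ U) ∧
      ∀ B ⊆ S ∩ U, MeasurableSet B → ∫⁻ x in B, J x ∂μ ≤ C * ν (F '' B))
    (hD : ∀ᵐ y ∂ν, ∀ t : Finset V, (∀ x ∈ t, x ∈ S ∧ F x = y) → t.card ≤ D)
    (hK : ∀ x ∈ S, F x ∈ K) (hKm : MeasurableSet K) :
    ∫⁻ x in S, J x ∂μ ≤ C * (D * ν K) := by
  set S' : Set V := {x | x ∈ S ∧ J x ≠ 0} with hS'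
  have e1 : ∫⁻ x in S, J x ∂μ = ∫⁻ x in S', J x ∂μ := by
    rw [← lintegral_indicator hS, ← lintegral_indicator hJS]
    congr 1
    ext x
    by_cases h1 : x ∈ S <;> by_cases h2 : J x = 0 <;> simp [hS', h1, h2]
  rw [e1]
  have hloc' : ∀ p : V, ∃ U : Set V, p ∈ S' → IsOpen U ∧ p ∈ U ∧ InjOn F (S ∩ U) ∧
      ∀ B ⊆ S ∩ U, MeasurableSet B → ∫⁻ x in B, J x ∂μ ≤ C * ν (F '' B) := by
    intro p
    by_cases hp : p ∈ S'
    · obtain ⟨U, hU, hi, hB⟩ := hloc p hp.1 hp.2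
      obtain ⟨W, hWU, hW, hpW⟩ := mem_nhds_iff.1 hU
      exact ⟨W, fun _ => ⟨hW, hpW, hi.mono (inter_subset_inter_right _ hWU),
        fun B hBs => hB B (hBs.trans (inter_subset_inter_right _ hWU))⟩⟩
    · exact ⟨univ, fun h => (hp h).elim⟩
  choose U hU using hloc'
  obtain ⟨t, htS, htc, hcov⟩ := TopologicalSpace.countable_cover_nhdsWithin (f := U) (s := S')
    fun x hx => mem_nhdsWithin_of_mem_nhds ((hU x hx).1.mem_nhds (hU x hx).2.1)
  rcases S'.eq_empty_or_nonempty with hemp | hne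
  · simp [hemp]
  have htne : t.Nonempty := by
    rcases t.eq_empty_or_nonempty with h | h
    · obtain ⟨x, hx⟩ := hne
      simpa [h] using hcov hx
    · exact h
  obtain ⟨f, rfl⟩ := htc.exists_eq_range htne
  have hfS : ∀ n, f n ∈ S' := fun n => htS ⟨n, rfl⟩
  -- the disjoint pieces
  let B : ℕ → Set V := fun n => S' ∩ disjointed (fun n => U (f n)) n
  have hUm : ∀ n, MeasurableSet (U (f n)) := fun n => (hU _ (hfS n)).1.measurableSet
  have hBm : ∀ n, MeasurableSet (B n) := fun n =>
    hJS.inter (MeasurableSet.disjointed hUm n)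
  have hBd : Pairwise (Function.onFun Disjoint B) := fun i j hij =>
    (disjoint_disjointed (fun n => U (f n)) hij).mono inter_subset_right inter_subset_right
  have hBU : ∀ n, B n ⊆ S ∩ U (f n) := fun n =>
    inter_subset_inter (fun x hx => hx.1) (disjointed_subset _ _)
  have hBunion : S' = ⋃ n, B n := by
    rw [← inter_iUnion, iUnion_disjointed, eq_comm, inter_eq_left]
    simpa using hcov
  have hFB : ∀ n, MeasurableSet (F '' B n) := fun n =>
    (hBm n).image_of_continuousOn_injOn (hF.mono ((hBU n).trans inter_subset_left))
      ((hU _ (hfS n)).2.2.1.mono (hBU n))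
  calc ∫⁻ x in S', J x ∂μ = ∑' n, ∫⁻ x in B n, J x ∂μ := by
        rw [hBunion, lintegral_iUnion hBm hBd]
    _ ≤ ∑' n, C * ν (F '' B n) :=
        ENNReal.tsum_le_tsum fun n => (hU _ (hfS n)).2.2.2 _ (hBU n) (hBm n)
    _ = C * ∑' n, ∫⁻ y, (F '' B n).indicator 1 y ∂ν := by
        rw [ENNReal.tsum_mul_left]
        simp only [lintegral_indicator_one (hFB _)]
    _ = C * ∫⁻ y, ∑' n, (F '' B n).indicator 1 y ∂ν := by
        rw [lintegral_tsum]
        exact fun n => (measurable_one.indicator (hFB n)).aemeasurable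
    _ ≤ C * ∫⁻ y, K.indicator (fun _ => (D : ℝ≥0∞)) y ∂ν := by
        gcongr 1
        refine lintegral_mono_ae ?_
        filter_upwards [hD] with y hy
        by_cases hyK : y ∈ K
        · rw [indicator_of_mem hyK, ENNReal.tsum_eq_iSup_sum]
          refine iSup_le fun s => ?_
          classical
          -- points of the fibre, one in each piece whose image contains `y`
          have hx : ∀ n : ℕ, ∃ x, y ∈ F '' B n → x ∈ B n ∧ F x = y := fun n => by
            by_cases h : y ∈ F '' B n
            · obtain ⟨x, hx⟩ := h
              exact ⟨x, fun _ => hx⟩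
            · exact ⟨f 0, fun h' => (h h').elim⟩
          choose x hx using hx
          have h1 : ∑ n ∈ s, (F '' B n).indicator (1 : Y → ℝ≥0∞) y =
              ((s.filter fun n => y ∈ F '' B n).card : ℝ≥0∞) := by
            rw [Finset.card_filter]
            push_cast
            exact Finset.sum_congr rfl fun n _ => by simp [indicator_apply]
          rw [h1]
          have h2 : ((s.filter fun n => y ∈ F '' B n).image x).card =
              (s.filter fun n => y ∈ F '' B n).card := by
            refine Finset.card_image_of_injOn fun i hi j hj hij => ?_
            by_contra hne
            refine (Set.disjoint_left.1 (hBd hne)) (hx i (Finset.mem_filter.1 hi).2).1 ?_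
            rw [show x i = x j from hij]
            exact (hx j (Finset.mem_filter.1 hj).2).1
          rw [← h2]
          norm_cast
          refine hy _ fun z hz => ?_
          obtain ⟨n, hn, rfl⟩ := Finset.mem_image.1 hz
          have := hx n (Finset.mem_filter.1 hn).2
          exact ⟨(hBU n this.1).1, this.2⟩
        · rw [indicator_of_notMem hyK]
          refine le_of_eq (ENNReal.tsum_eq_zero.2 fun n => indicator_of_notMem ?_ _)
          rintro ⟨x, hx, rfl⟩
          exact hyK (hK x (hBU n hx).1)
    _ = C * (D * ν K) := by rw [lintegral_indicator hKm, setLIntegral_const]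

end

noncomputable section

/-! ### Generic fibres of rational maps -/

open Set MvPolynomial

theorem MvPolynomial.ae_eval_ne_zero_fin {n : ℕ} {Q : MvPolynomial (Fin n) ℝ} (hQ : Q ≠ 0) :
    ∀ᵐ y : Fin n → ℝ, eval y Q ≠ 0 := by
  induction n with
  | zero =>
    refine Filter.Eventually.of_forall fun y h => hQ (MvPolynomial.funext fun x => ?_)
    rw [Subsingleton.elim x y, h, map_zero]
  | succ n ih =>
    have hne : finSuccEquiv ℝ n Q ≠ 0 := by simpa using hQ
    have hm : MeasurableSet {y : Fin (n + 1) → ℝ | eval y Q ≠ 0} :=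
      (isOpen_ne_fun (MvPolynomial.continuous_eval Q) continuous_const).measurableSet
    have hmp := (volume_preserving_piFinSuccAbove (fun _ : Fin (n + 1) => ℝ) 0).symm
    rw [← hmp.map_eq, ae_map_iff hmp.measurable.aemeasurable hm, Measure.volume_eq_prod]
    refine (Measure.ae_prod_iff_ae_ae (hmp.measurable hm)).2
      ((Measure.ae_ae_comm (p := fun r w => (MeasurableEquiv.piFinSuccAbove
        (fun _ : Fin (n + 1) => ℝ) 0).symm (r, w) ∈ {y | eval y Q ≠ 0}) (hmp.measurable hm)).2 ?_)
    filter_upwards [ih (Polynomial.leadingCoeff_ne_zero.2 hne)] with w hw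
    have hp : Polynomial.map (eval w) (finSuccEquiv ℝ n Q) ≠ 0 := fun h => hw (by
      have := congrArg (fun p => p.coeff (finSuccEquiv ℝ n Q).natDegree) h
      simpa using this)
    have hfin := (Polynomial.map (eval w) (finSuccEquiv ℝ n Q)).roots.toFinset.finite_toSet
    refine measure_mono_null ?_ (hfin.measure_zero volume)
    intro r hr
    simp only [ne_eq, compl_def, mem_ofPred_eq, not_not] at hr
    have : (MeasurableEquiv.piFinSuccAbove (fun _ : Fin (n + 1) => ℝ) 0).symm (r, w) =
      Fin.cons r w := by simp [MeasurableEquiv.piFinSuccAbove, Fin.insertNthEquiv]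
    rw [this, eval_eq_eval_mv_eval'] at hr
    simpa [hp] using hr

/-- The zero set of a nonzero polynomial is a null set. -/
theorem MvPolynomial.ae_eval_ne_zero {ι : Type*} [Fintype ι] {Q : MvPolynomial ι ℝ} (hQ : Q ≠ 0) :
    ∀ᵐ y : ι → ℝ, eval y Q ≠ 0 := by
  let e := Fintype.equivFin ι
  have h := ae_eval_ne_zero_fin (Q := rename e Q)
    (by simpa using (rename_injective e e.injective).ne hQ)
  have hmp := volume_preserving_arrowCongr' e (MeasurableEquiv.refl ℝ) (MeasurePreserving.id _)
  filter_upwards [hmp.quasiMeasurePreserving.ae h] with y hy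
  have he : (MeasurableEquiv.arrowCongr' e (MeasurableEquiv.refl ℝ)) y ∘ e = y := by
    ext i
    simp [MeasurableEquiv.arrowCongr', Equiv.arrowCongr']
  rwa [eval_rename, he] at hy

/-- The pairs `(k, r)` such that the rational function `k` is defined at the point `x`, with
value `r`. -/
def regularValues {σ : Type*} (x : σ → ℝ) :
    Subalgebra ℝ (FractionRing (MvPolynomial σ ℝ) × ℝ) where
  carrier := {kr | ∃ n d : MvPolynomial σ ℝ, eval x d ≠ 0 ∧
    kr.1 = algebraMap _ _ n / algebraMap _ _ d ∧ kr.2 = eval x n / eval x d}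
  mul_mem' := by
    rintro ⟨_, _⟩ ⟨_, _⟩ ⟨n, d, hd, rfl, rfl⟩ ⟨n', d', hd', rfl, rfl⟩
    exact ⟨n * n', d * d', by simp [hd, hd'], by simp [div_mul_div_comm],
      by simp [div_mul_div_comm]⟩
  add_mem' := by
    rintro ⟨_, _⟩ ⟨_, _⟩ ⟨n, d, hd, rfl, rfl⟩ ⟨n', d', hd', rfl, rfl⟩
    have h1 : algebraMap _ (FractionRing (MvPolynomial σ ℝ)) d ≠ 0 := by
      have : d ≠ 0 := by rintro rfl; simp at hd
      simpa using this
    have h2 : algebraMap _ (FractionRing (MvPolynomial σ ℝ)) d' ≠ 0 := by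
      have : d' ≠ 0 := by rintro rfl; simp at hd'
      simpa using this
    exact ⟨n * d' + d * n', d * d', by simp [hd, hd'], by simp [div_add_div _ _ h1 h2],
      by simp [div_add_div _ _ hd hd']⟩
  algebraMap_mem' r := ⟨C r, 1, by simp, by
    rw [map_one, div_one, ← MvPolynomial.algebraMap_eq, ← IsScalarTower.algebraMap_apply]; rfl,
    by simp⟩

/-- More rational functions than there are variables satisfy a polynomial relation; the relation
holds between their values, wherever they are all defined. -/
theorem exists_polynomial_relation {σ τ : Type*} [Fintype σ] [Fintype τ]
    (hcard : Fintype.card σ < Fintype.card τ) {n d : τ → MvPolynomial σ ℝ} :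
    ∃ P : MvPolynomial τ ℝ, P ≠ 0 ∧ ∀ x : σ → ℝ, (∀ i, eval x (d i) ≠ 0) →
      eval (fun i => eval x (n i) / eval x (d i)) P = 0 := by
  let K := FractionRing (MvPolynomial σ ℝ)
  let y : τ → K := fun i => algebraMap _ K (n i) / algebraMap _ K (d i)
  have hdep : ¬ AlgebraicIndependent ℝ y := by
    intro h
    have h1 := h.lift_cardinalMk_le_trdeg
    have h2 : Algebra.trdeg ℝ K = Algebra.trdeg ℝ (MvPolynomial σ ℝ) := by
      have h3 := lift_trdeg_add_eq ℝ (MvPolynomial σ ℝ) K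
      have : Algebra.IsAlgebraic (MvPolynomial σ ℝ) K :=
        IsLocalization.isAlgebraic _ (nonZeroDivisors (MvPolynomial σ ℝ))
      rw [trdeg_eq_zero (R := MvPolynomial σ ℝ)] at h3
      simpa using h3.symm
    rw [h2] at h1
    simp at h1
    omega
  rw [algebraicIndependent_iff] at hdep
  push Not at hdep
  obtain ⟨P, hP, hP0⟩ := hdep
  refine ⟨P, hP0, fun x hx => ?_⟩
  have hmem : ∀ P : MvPolynomial τ ℝ,
      aeval (fun i => (y i, eval x (n i) / eval x (d i))) P ∈ regularValues x := by
    intro P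
    induction P using MvPolynomial.induction_on with
    | C a => rw [aeval_C]; exact Subalgebra.algebraMap_mem _ _
    | add p q hp hq => rw [map_add]; exact add_mem hp hq
    | mul_X p i hp =>
      rw [map_mul, aeval_X]
      exact mul_mem hp ⟨n i, d i, hx i, rfl, rfl⟩
  obtain ⟨n', d', hd', h1, h2⟩ := hmem P
  have e1 : (aeval (fun i => (y i, eval x (n i) / eval x (d i))) P).1 = aeval y P :=
    comp_aeval_apply _ (AlgHom.fst ℝ K ℝ) P
  have e2 : (aeval (fun i => (y i, eval x (n i) / eval x (d i))) P).2 =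
      eval (fun i => eval x (n i) / eval x (d i)) P :=
    (comp_aeval_apply _ (AlgHom.snd ℝ K ℝ) P).trans (DFunLike.congr_fun (coe_aeval_eq_eval _) P)
  rw [e1, hP] at h1
  have hd0 : algebraMap _ K d' ≠ 0 := by
    have : d' ≠ 0 := by rintro rfl; simp at hd'
    simpa [K] using this
  have hn0 : n' = 0 := by
    have := (div_eq_zero_iff.1 h1.symm).resolve_right hd0
    simpa [K] using this
  rw [← e2, h2, hn0, map_zero, zero_div]

theorem eval_option_elim {τ : Type*} (r : ℝ) (w : τ → ℝ) (P : MvPolynomial (Option τ) ℝ) :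
    eval (fun o => Option.elim o r w) P =
      ((optionEquivLeft ℝ τ P).map (eval w)).eval r := by
  induction P using MvPolynomial.induction_on with
  | C a => simp
  | add p q hp hq => simp [hp, hq]
  | mul_X p i hp => cases i <;> simp [hp]

theorem eval_sum_elim {ι κ : Type*} (y : ι → ℝ) (z : κ → ℝ) (Q : MvPolynomial (ι ⊕ κ) ℝ) :
    eval (Sum.elim y z) Q = eval y (MvPolynomial.map (eval z) (sumAlgEquiv ℝ ι κ Q)) := by
  induction Q using MvPolynomial.induction_on with
  | C a => simp
  | add p q hp hq => simp [hp, hq]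
  | mul_X p i hp => cases i <;> simp [hp]

/-- For almost every `y`, the polynomials `P l (y, z, ·)` have finitely many zeros, with a bound
independent of `y`; here `z` is chosen suitably in a given box with infinite sides. -/
theorem exists_ae_card_roots_le {σ ι κ : Type*} [Fintype σ] [Fintype ι]
    {P : σ → MvPolynomial (Option (ι ⊕ κ)) ℝ} (hP : ∀ l, P l ≠ 0) {s : κ → Set ℝ}
    (hs : ∀ k, (s k).Infinite) :
    ∃ z ∈ Set.pi univ s, ∃ D : σ → ℕ, ∀ᵐ y : ι → ℝ, ∀ l, ∃ R : Finset ℝ, R.card ≤ D l ∧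
      ∀ r, eval (fun o => Option.elim o r (Sum.elim y z)) (P l) = 0 → r ∈ R := by
  let Q : MvPolynomial (ι ⊕ κ) ℝ := ∏ l, (optionEquivLeft ℝ _ (P l)).leadingCoeff
  have hQ : sumAlgEquiv ℝ ι κ Q ≠ 0 := by
    simp [Q, Finset.prod_eq_zero_iff, hP]
  obtain ⟨m, hm⟩ := MvPolynomial.ne_zero_iff.1 hQ
  obtain ⟨z, hz, hzm⟩ : ∃ z ∈ Set.pi univ s, eval z (coeff m (sumAlgEquiv ℝ ι κ Q)) ≠ 0 := by
    by_contra! h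
    exact hm (funext_set s hs fun z hz => by rw [h z hz, map_zero])
  have hne : MvPolynomial.map (eval z) (sumAlgEquiv ℝ ι κ Q) ≠ 0 :=
    MvPolynomial.ne_zero_iff.2 ⟨m, by rwa [coeff_map]⟩
  refine ⟨z, hz, fun l => (optionEquivLeft ℝ _ (P l)).natDegree, ?_⟩
  filter_upwards [ae_eval_ne_zero hne] with y hy l
  rw [← eval_sum_elim, map_prod] at hy
  have hl := Finset.prod_ne_zero_iff.1 hy l (Finset.mem_univ l)
  have hp : Polynomial.map (eval (Sum.elim y z)) (optionEquivLeft ℝ _ (P l)) ≠ 0 := fun h => hl (by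
    have := congrArg (fun p => p.coeff (optionEquivLeft ℝ _ (P l)).natDegree) h
    simpa [Polynomial.leadingCoeff] using this)
  refine ⟨(Polynomial.map (eval (Sum.elim y z)) (optionEquivLeft ℝ _ (P l))).roots.toFinset,
    (Multiset.toFinset_card_le _).trans ((Polynomial.card_roots' _).trans
      Polynomial.natDegree_map_le), fun r hr => ?_⟩
  rw [eval_option_elim] at hr
  simpa [hp] using hr

/-- If the points of `S` can be placed in affine space, by maps `g z` for all `z` in a box, so that
given rational functions `n i / d i` take the values `F x i` and given polynomials `q k` the
values `z k`, there being at least as many of these functions as there are coordinates, then almost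
all fibres of `F` in `S` are finite, with a uniform bound. -/
theorem exists_ae_fibre_card_le {σ ι κ X : Type*} [Fintype σ] [Fintype ι] [Fintype κ]
    (hcard : Fintype.card σ ≤ Fintype.card ι + Fintype.card κ)
    {n d : ι → MvPolynomial σ ℝ} {q : κ → MvPolynomial σ ℝ} {s : κ → Set ℝ}
    (hs : ∀ k, (s k).Infinite) {S : Set X} {F : X → ι → ℝ} (g : (κ → ℝ) → X → σ → ℝ)
    (hinj : ∀ z ∈ Set.pi univ s, InjOn (g z) S)
    (hd : ∀ z ∈ Set.pi univ s, ∀ x ∈ S, ∀ i, eval (g z x) (d i) ≠ 0)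
    (hn : ∀ z ∈ Set.pi univ s, ∀ x ∈ S, ∀ i, eval (g z x) (n i) / eval (g z x) (d i) = F x i)
    (hq : ∀ z ∈ Set.pi univ s, ∀ x ∈ S, ∀ k, eval (g z x) (q k) = z k) :
    ∃ D : ℕ, ∀ᵐ y : ι → ℝ, ∀ t : Finset X, (∀ x ∈ t, x ∈ S ∧ F x = y) → t.card ≤ D := by
  classical
  have hrel : ∀ l : σ, ∃ P : MvPolynomial (Option (ι ⊕ κ)) ℝ, P ≠ 0 ∧
      ∀ x : σ → ℝ, (∀ i, eval x (d i) ≠ 0) →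
        eval (fun o => Option.elim o (x l) (Sum.elim (fun i => eval x (n i) / eval x (d i))
          fun k => eval x (q k))) P = 0 := by
    intro l
    obtain ⟨P, hP, h⟩ := exists_polynomial_relation (σ := σ) (τ := Option (ι ⊕ κ))
      (by simp; omega) (n := fun o => Option.elim o (MvPolynomial.X l) (Sum.elim n q))
      (d := fun o => Option.elim o 1 (Sum.elim d fun _ => 1))
    refine ⟨P, hP, fun x hx => ?_⟩
    rw [← h x fun o => by rcases o with _ | i | k <;> simp [hx]]
    congr 2
    ext o
    rcases o with _ | i | k <;> simp
  choose P hP hPx using hrel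
  obtain ⟨z, hz, D, hD⟩ := exists_ae_card_roots_le hP hs
  refine ⟨∏ l, D l, ?_⟩
  filter_upwards [hD] with y hy t ht
  choose R hR hRr using hy
  calc t.card ≤ (Fintype.piFinset R).card := by
        refine Finset.card_le_card_of_injOn (g z) (fun x hx => ?_)
          ((hinj z hz).mono fun x hx => (ht x hx).1)
        obtain ⟨hxS, rfl⟩ := ht x hx
        refine Finset.mem_coe.2 (Fintype.mem_piFinset.2 fun l => hRr l _ ?_)
        have := hPx l (g z x) (hd z hz x hxS)
        simpa only [hn z hz x hxS, hq z hz x hxS] using this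
    _ ≤ ∏ l, D l := by
        rw [Fintype.card_piFinset]
        exact Finset.prod_le_prod' fun l _ => hR l

end

noncomputable section

/-! ### Wedge products of decomposable two-forms -/

/-- The wedge product of the decomposable two-forms `c e • f (e, 0) ∧ f (e, 1)` is a determinant. -/
theorem wedgeTwoForms_eq_det {E W : Type*} [Fintype E] [DecidableEq E] {α : E → W → W → ℝ}
    {c : E → ℝ} {f : E × Fin 2 → W → ℝ}
    (hα : ∀ e x y, α e x y = c e * (f (e, 0) x * f (e, 1) y - f (e, 0) y * f (e, 1) x))
    (v : E × Fin 2 → W) :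
    wedgeTwoForms α v = (∏ e, c e) * (Matrix.of fun r s => f r (v s)).det := by
  have hprod : ∀ σ : Equiv.Perm (E × Fin 2), ∏ e, α e (v (σ (e, 0))) (v (σ (e, 1))) =
      (∏ e, c e) * ∑ T : E → Equiv.Perm (Fin 2),
        ((Equiv.Perm.sign (Equiv.prodCongrRight T) : ℤ) : ℝ) *
          ∏ h, f h (v ((σ * Equiv.prodCongrRight T) h)) := by
    intro σ
    simp only [hα, Finset.prod_mul_distrib]
    congr 1
    have h1 : ∀ e, f (e, 0) (v (σ (e, 0))) * f (e, 1) (v (σ (e, 1))) -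
        f (e, 0) (v (σ (e, 1))) * f (e, 1) (v (σ (e, 0))) =
        ∑ τ : Equiv.Perm (Fin 2), ((Equiv.Perm.sign τ : ℤ) : ℝ) *
          ∏ i, f (e, i) (v (σ (e, τ i))) := by
      intro e
      have := Matrix.det_apply' (Matrix.of fun i j : Fin 2 => f (e, j) (v (σ (e, i))))
      rw [Matrix.det_fin_two] at this
      simp only [Matrix.of_apply] at this
      rw [← this]
      ring
    simp only [h1]
    rw [Finset.prod_univ_sum, Fintype.piFinset_univ]
    refine Finset.sum_congr rfl fun T _ => ?_
    rw [Finset.prod_mul_distrib, Equiv.Perm.sign_prodCongrRight, Fintype.prod_prod_type]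
    push_cast
    rfl
  have hT : ∀ T : E → Equiv.Perm (Fin 2), ∑ σ : Equiv.Perm (E × Fin 2),
      ((Equiv.Perm.sign σ : ℤ) : ℝ) * (((Equiv.Perm.sign (Equiv.prodCongrRight T) : ℤ) : ℝ) *
          ∏ h, f h (v ((σ * Equiv.prodCongrRight T) h))) =
        (Matrix.of fun r s => f r (v s)).det := by
    intro T
    rw [← Matrix.det_transpose, Matrix.det_apply']
    refine Fintype.sum_equiv (Equiv.mulRight (Equiv.prodCongrRight T)) _ _ fun σ => ?_
    simp only [Equiv.coe_mulRight, Equiv.Perm.sign_mul, Matrix.transpose_apply, Matrix.of_apply]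
    push_cast
    ring
  unfold wedgeTwoForms
  simp only [hprod, Finset.mul_sum, mul_left_comm _ (∏ e, c e)]
  rw [Finset.sum_comm]
  simp only [← Finset.mul_sum, hT]
  have hc : (Fintype.card (E → Equiv.Perm (Fin 2)) : ℝ) = 2 ^ Fintype.card E := by
    simp [Fintype.card_perm]
  rw [Finset.sum_const, Finset.card_univ, nsmul_eq_mul, hc]
  field_simp

/-! ### Edge vectors, slopes and the edge forms -/

namespace AnomalySpace

variable {O I : Type*} [Fintype O] [Fintype I]

/-- The component `a`, as a continuous linear map. -/
def aL : AnomalySpace O I →L[ℝ] EuclideanSpace ℝ (Fin 3) :=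
  LinearMap.toContinuousLinearMap
    { toFun := a, map_add' := fun _ _ => rfl, map_smul' := fun _ _ => rfl }

/-- The component `η_i`, as a continuous linear map. -/
def etaL (i : O) : AnomalySpace O I →L[ℝ] ℝ :=
  LinearMap.toContinuousLinearMap
    { toFun := fun p => p.eta i, map_add' := fun _ _ => rfl, map_smul' := fun _ _ => rfl }

/-- The component `ω_j`, as a continuous linear map. -/
def omL (j : I) : AnomalySpace O I →L[ℝ] EuclideanSpace ℝ (Fin 3) :=
  LinearMap.toContinuousLinearMap
    { toFun := fun p => p.om j, map_add' := fun _ _ => rfl, map_smul' := fun _ _ => rfl }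

@[simp] theorem aL_apply (p : AnomalySpace O I) : aL p = p.a := rfl
@[simp] theorem etaL_apply (i : O) (p : AnomalySpace O I) : etaL i p = p.eta i := rfl
@[simp] theorem omL_apply (j : I) (p : AnomalySpace O I) : omL j p = p.om j := rfl

/-- The derivative at `p` of the position of a vertex. -/
def posDeriv (p : AnomalySpace O I) : O ⊕ I → AnomalySpace O I →L[ℝ] EuclideanSpace ℝ (Fin 3)
  | Sum.inl i => p.eta i • aL + (etaL i).smulRight p.a
  | Sum.inr j => omL j

theorem hasStrictFDerivAt_pos (p : AnomalySpace O I) (x : O ⊕ I) :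
    HasStrictFDerivAt (fun q : AnomalySpace O I => q.pos x) (p.posDeriv x) p := by
  rcases x with i | j
  · have h1 : HasStrictFDerivAt (fun q : AnomalySpace O I => q.eta i) (etaL i) p :=
      (etaL i).hasStrictFDerivAt
    have h2 : HasStrictFDerivAt (fun q : AnomalySpace O I => q.a) aL p := aL.hasStrictFDerivAt
    exact h1.smul h2
  · exact (omL j).hasStrictFDerivAt

end AnomalySpace

/-- The derivative of the direction of a vector is, up to a multiple of the vector, the quotient
by its norm. -/
theorem exists_hasFDerivAt_unitVector {x : EuclideanSpace ℝ (Fin 3)} (hx : x ≠ 0) :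
    ∃ b : EuclideanSpace ℝ (Fin 3) →L[ℝ] ℝ,
      HasFDerivAt unitVector (‖x‖⁻¹ • ContinuousLinearMap.id ℝ _ + b.smulRight x) x := by
  have h : DifferentiableAt ℝ (fun y : EuclideanSpace ℝ (Fin 3) => ‖y‖⁻¹) x :=
    ((differentiableAt_id (𝕜 := ℝ)).norm ℝ hx).inv (norm_ne_zero_iff.2 hx)
  exact ⟨_, h.hasFDerivAt.smul (hasFDerivAt_id x)⟩

theorem gaussForm_smul_add (x y z : EuclideanSpace ℝ (Fin 3)) (r s t : ℝ) :
    gaussForm (r • x) (r • y + s • x) (r • z + t • x) = r ^ 3 * gaussForm x y z := by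
  simp [gaussForm]
  ring

/-- The two indices following `k` in the cyclic order. -/
def slopeIndex (k : Fin 3) (i : Fin 2) : Fin 3 := k + i.succ

/-- The derivative, in the direction `y`, of the slope `x j / x k`. -/
def slopeDeriv (x y : EuclideanSpace ℝ (Fin 3)) (k j : Fin 3) : ℝ :=
  (x k * y j - x j * y k) / x k ^ 2

/-- In the affine chart of slopes with respect to the `k`-th coordinate, the Gauss form is a
multiple of the area form. -/
theorem gaussForm_eq_slopeDeriv {x : EuclideanSpace ℝ (Fin 3)} (y z : EuclideanSpace ℝ (Fin 3))
    {k : Fin 3} (hk : x k ≠ 0) :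
    gaussForm x y z = 1 / (4 * Real.pi) * x k ^ 3 *
      (slopeDeriv x y k (slopeIndex k 0) * slopeDeriv x z k (slopeIndex k 1) -
        slopeDeriv x z k (slopeIndex k 0) * slopeDeriv x y k (slopeIndex k 1)) := by
  unfold gaussForm slopeDeriv
  rw [mul_assoc]
  congr 1
  fin_cases k <;> simp [slopeIndex] at hk ⊢ <;> field_simp <;> ring

namespace WilsonGraph

variable {O I E : Type*} [Fintype O] [Fintype I]

/-- The vector from the origin of an oriented edge to its end. -/
def edgeVector (G : WilsonGraph O I E) (p : AnomalySpace O I) (e : E) : EuclideanSpace ℝ (Fin 3) :=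
  p.pos (G.bd e 1) - p.pos (G.bd e 0)

/-- The derivative at `p` of the edge vector. -/
def edgeDeriv (G : WilsonGraph O I E) (p : AnomalySpace O I) (e : E) :
    AnomalySpace O I →L[ℝ] EuclideanSpace ℝ (Fin 3) :=
  p.posDeriv (G.bd e 1) - p.posDeriv (G.bd e 0)

theorem hasStrictFDerivAt_edgeVector (G : WilsonGraph O I E) (p : AnomalySpace O I) (e : E) :
    HasStrictFDerivAt (fun q => G.edgeVector q e) (G.edgeDeriv p e) p :=
  (p.hasStrictFDerivAt_pos _).sub (p.hasStrictFDerivAt_pos _)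

theorem continuous_edgeVector (G : WilsonGraph O I E) (e : E) :
    Continuous fun p => G.edgeVector p e :=
  continuous_iff_continuousAt.2 fun p =>
    (G.hasStrictFDerivAt_edgeVector p e).hasFDerivAt.continuousAt

theorem edgeForm_eq_gaussForm (G : WilsonGraph O I E) {p : AnomalySpace O I} {e : E}
    (h : G.edgeVector p e ≠ 0) (v w : AnomalySpace O I) :
    G.edgeForm p e v w = ‖G.edgeVector p e‖⁻¹ ^ 3 *
      gaussForm (G.edgeVector p e) (G.edgeDeriv p e v) (G.edgeDeriv p e w) := by
  obtain ⟨b, hb⟩ := exists_hasFDerivAt_unitVector h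
  have h1 : HasFDerivAt (G.gaussMap e) _ p :=
    hb.comp p (G.hasStrictFDerivAt_edgeVector p e).hasFDerivAt
  rw [edgeForm, h1.fderiv, ← gaussForm_smul_add _ _ _ _ (b (G.edgeDeriv p e v))
    (b (G.edgeDeriv p e w))]
  rfl

/-- The derivative of a slope of an edge vector. -/
def slopeForm (G : WilsonGraph O I E) (k : E → Fin 3) (p : AnomalySpace O I) (h : E × Fin 2) :
    AnomalySpace O I →L[ℝ] ℝ :=
  (G.edgeVector p h.1 (k h.1) ^ 2)⁻¹ •
    (G.edgeVector p h.1 (k h.1) •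
        (EuclideanSpace.proj (slopeIndex (k h.1) h.2) ∘L G.edgeDeriv p h.1) -
      G.edgeVector p h.1 (slopeIndex (k h.1) h.2) •
        (EuclideanSpace.proj (k h.1) ∘L G.edgeDeriv p h.1))

theorem slopeForm_apply (G : WilsonGraph O I E) (k : E → Fin 3) (p w : AnomalySpace O I)
    (h : E × Fin 2) :
    G.slopeForm k p h w = slopeDeriv (G.edgeVector p h.1) (G.edgeDeriv p h.1 w) (k h.1)
      (slopeIndex (k h.1) h.2) := by
  simp [slopeForm, slopeDeriv, div_eq_inv_mul]

/-- The factor by which the Gauss form of an edge differs from the area form of the slopes. -/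
def edgeFactor (G : WilsonGraph O I E) (k : E → Fin 3) (p : AnomalySpace O I) (e : E) : ℝ :=
  1 / (4 * Real.pi) * (G.edgeVector p e (k e) / ‖G.edgeVector p e‖) ^ 3

theorem edgeForm_eq_slopeForm (G : WilsonGraph O I E) {k : E → Fin 3} {p : AnomalySpace O I}
    {e : E} (h : G.edgeVector p e (k e) ≠ 0) (v w : AnomalySpace O I) :
    G.edgeForm p e v w = G.edgeFactor k p e *
      (G.slopeForm k p (e, 0) v * G.slopeForm k p (e, 1) w -
        G.slopeForm k p (e, 0) w * G.slopeForm k p (e, 1) v) := by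
  have h0 : G.edgeVector p e ≠ 0 := fun h' => h (by rw [h']; rfl)
  rw [edgeForm_eq_gaussForm G h0, gaussForm_eq_slopeDeriv _ _ h]
  simp only [slopeForm_apply, edgeFactor, div_pow, inv_pow]
  ring

/-- The slopes of all the edge vectors, with respect to chosen coordinates. -/
def slopeMap [Fintype E] (G : WilsonGraph O I E) (k : E → Fin 3) (p : AnomalySpace O I) :
    EuclideanSpace ℝ (E × Fin 2) :=
  WithLp.toLp 2 fun h => G.edgeVector p h.1 (slopeIndex (k h.1) h.2) / G.edgeVector p h.1 (k h.1)

theorem hasStrictFDerivAt_slopeMap [Fintype E] (G : WilsonGraph O I E) {k : E → Fin 3}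
    {p : AnomalySpace O I} (hp : ∀ e, G.edgeVector p e (k e) ≠ 0) :
    ∃ F' : AnomalySpace O I →L[ℝ] EuclideanSpace ℝ (E × Fin 2),
      HasStrictFDerivAt (G.slopeMap k) F' p ∧ ∀ w h, F' w h = G.slopeForm k p h w := by
  refine ⟨((PiLp.continuousLinearEquiv 2 ℝ fun _ : E × Fin 2 => ℝ).symm :
    (E × Fin 2 → ℝ) →L[ℝ] EuclideanSpace ℝ (E × Fin 2)) ∘L
      ContinuousLinearMap.pi fun h => G.slopeForm k p h, ?_, fun w h => rfl⟩
  rw [hasStrictFDerivAt_euclidean]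
  intro h
  have hd : ∀ j : Fin 3, HasStrictFDerivAt (fun q => G.edgeVector q h.1 j)
      ((EuclideanSpace.proj j : EuclideanSpace ℝ (Fin 3) →L[ℝ] ℝ) ∘L G.edgeDeriv p h.1) p :=
    fun j => (EuclideanSpace.proj j : EuclideanSpace ℝ (Fin 3) →L[ℝ] ℝ).hasStrictFDerivAt.comp p
      (G.hasStrictFDerivAt_edgeVector p h.1)
  have h1 := (hd (slopeIndex (k h.1) h.2)).mul
    ((hasStrictDerivAt_inv (hp h.1)).comp_hasStrictFDerivAt p (hd (k h.1)))
  refine h1.congr_fderiv ?_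
  ext w
  have := hp h.1
  simp [slopeForm_apply, slopeDeriv]
  field_simp
  ring

end WilsonGraph
end

noncomputable section

/-! ### The tangent space and the volume form of the anomaly variety -/

/-- Evaluating linear forms on a family of vectors amounts to multiplying the matrix of the
coefficients of the forms with the matrix of the coordinates of the vectors. -/
theorem Matrix.of_apply_eq_mul {σ τ : Type*} [Fintype σ] [DecidableEq σ] [Fintype τ] (ρ : τ ≃ σ)
    (φ : τ → EuclideanSpace ℝ σ →L[ℝ] ℝ) (w : τ → EuclideanSpace ℝ σ) :
    (Matrix.of fun r c => φ r (w c)) =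
      (Matrix.of fun r s => φ r (EuclideanSpace.single (ρ s) 1)) *
        Matrix.of fun r c => w c (ρ r) := by
  ext r c
  have h : w c = ∑ s, w c (ρ s) • EuclideanSpace.single (ρ s) (1 : ℝ) := by
    rw [Equiv.sum_comp ρ fun x => w c x • EuclideanSpace.single x (1 : ℝ)]
    ext x
    simp [Pi.single_apply]
  rw [Matrix.mul_apply, Matrix.of_apply]
  conv_lhs => rw [h]
  simp [mul_comm]

namespace AnomalySpace

variable {O I : Type*} [Fintype O] [Fintype I]

theorem inner_eq (v w : AnomalySpace O I) :
    inner ℝ v w = inner ℝ v.a w.a + (∑ i, v.eta i * w.eta i + ∑ j, inner ℝ (v.om j) (w.om j)) := by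
  simp [PiLp.inner_apply, Fintype.sum_sum_type, Fintype.sum_prod_type, a, eta, om, mul_comm]

/-- The gradients at `p` of (half) the squared norms of `a` and `(η, ω)`, and of
`∑ η_i + ∑ ⟨ω_j, a⟩`. -/
def normal (p : AnomalySpace O I) : Fin 3 → AnomalySpace O I :=
  ![p.radial, p.dilatation,
    WithLp.toLp 2 (Sum.elim (fun k => (∑ j, p.om j) k) (Sum.elim (fun _ => 1) fun jk => p.a jk.2))]

theorem inner_radial (p v : AnomalySpace O I) : inner ℝ p.radial v = inner ℝ p.a v.a := by
  rw [inner_eq]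
  simp [radial, a, eta, om, PiLp.inner_apply]

theorem inner_dilatation (p v : AnomalySpace O I) :
    inner ℝ p.dilatation v = ∑ i, p.eta i * v.eta i + ∑ j, inner ℝ (p.om j) (v.om j) := by
  rw [inner_eq]
  simp [dilatation, a, eta, om, PiLp.inner_apply]

theorem inner_normal_two (p v : AnomalySpace O I) :
    inner ℝ (p.normal 2) v =
      ∑ i, v.eta i + ∑ j, (inner ℝ (v.om j) p.a + inner ℝ (p.om j) v.a) := by
  rw [inner_eq, Finset.sum_add_distrib]
  have h1 : (p.normal 2).a = ∑ j, p.om j := rfl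
  have h2 : ∀ i, (p.normal 2).eta i = 1 := fun i => rfl
  have h3 : ∀ j, (p.normal 2).om j = p.a := fun j => rfl
  have h4 : ∀ j, inner ℝ p.a (v.om j) = inner ℝ (v.om j) p.a := fun j => real_inner_comm _ _
  simp only [h1, h2, h3, h4, one_mul, sum_inner]
  ring

theorem isTangent_iff (p v : AnomalySpace O I) :
    p.IsTangent v ↔ ∀ i, inner ℝ (p.normal i) v = 0 := by
  rw [Fin.forall_fin_succ, Fin.forall_fin_two]
  change _ ↔ inner ℝ p.radial v = 0 ∧ inner ℝ p.dilatation v = 0 ∧ inner ℝ (p.normal 2) v = 0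
  rw [inner_radial, inner_dilatation, inner_normal_two]
  rfl

/-- The radial vector, the dilatation and the translation at `p`. -/
def vertical (p : AnomalySpace O I) : Fin 3 → AnomalySpace O I :=
  ![p.radial, p.dilatation, p.translation]

theorem det_inner_normal_vertical {p : AnomalySpace O I} (ha : ‖p.a‖ = 1)
    (hD : ∑ i, p.eta i ^ 2 + ∑ j, ‖p.om j‖ ^ 2 = 1)
    (hT : ∑ i, p.eta i + ∑ j, inner ℝ (p.om j) p.a = 0) :
    (Matrix.of fun i j => inner ℝ (p.normal i) (p.vertical j)).det =
      Fintype.card O + Fintype.card I := by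
  have haa : inner ℝ p.a p.a = (1 : ℝ) := by rw [real_inner_self_eq_norm_sq, ha, one_pow]
  have e00 : inner ℝ (p.normal 0) (p.vertical 0) = (1 : ℝ) := (inner_radial _ _).trans haa
  have e01 : inner ℝ (p.normal 0) (p.vertical 1) = (0 : ℝ) :=
    (inner_radial _ _).trans (inner_zero_right _)
  have e02 : inner ℝ (p.normal 0) (p.vertical 2) = (0 : ℝ) :=
    (inner_radial _ _).trans (inner_zero_right _)
  have e11 : inner ℝ (p.normal 1) (p.vertical 1) = (1 : ℝ) := by
    refine (inner_dilatation _ _).trans ?_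
    rw [← hD]
    simp only [← real_inner_self_eq_norm_sq, sq (p.eta _)]
    rfl
  have e12 : inner ℝ (p.normal 1) (p.vertical 2) = (0 : ℝ) := by
    refine (inner_dilatation _ _).trans ?_
    rw [← hT]
    congr 1
    exact Finset.sum_congr rfl fun i _ => mul_one _
  have e21 : inner ℝ (p.normal 2) (p.vertical 1) = (0 : ℝ) := by
    rw [inner_normal_two, ← hT]
    congr 1
    refine Finset.sum_congr rfl fun j _ => ?_
    exact (congrArg _ (inner_zero_right _)).trans (add_zero _)
  have e22 : inner ℝ (p.normal 2) (p.vertical 2) = (Fintype.card O + Fintype.card I : ℝ) := by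
    rw [inner_normal_two]
    have h1 : ∀ i, (p.vertical 2).eta i = 1 := fun i => rfl
    have h2 : ∀ j, (p.vertical 2).om j = p.a := fun j => rfl
    have h3 : (p.vertical 2).a = 0 := rfl
    simp [h1, h2, h3, ha]
  rw [Matrix.det_fin_three]
  simp [e00, e01, e02, e11, e12, e21, e22]

/-- The Gram determinant of the gradients of the constraints. -/
def gramDet (p : AnomalySpace O I) : ℝ :=
  (Matrix.of fun i j => inner ℝ (p.normal i) (p.normal j)).det

/-- The tangent space of the anomaly variety. -/
def tangentSpace (p : AnomalySpace O I) : Submodule ℝ (AnomalySpace O I) :=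
  (Submodule.span ℝ (Set.range p.normal))ᗮ

theorem mem_tangentSpace {p v : AnomalySpace O I} :
    v ∈ p.tangentSpace ↔ p.IsTangent v := by
  rw [isTangent_iff, tangentSpace, Submodule.mem_orthogonal]
  refine ⟨fun h i => h _ (Submodule.subset_span ⟨i, rfl⟩), fun h u hu => ?_⟩
  induction hu using Submodule.span_induction with
  | mem x hx => obtain ⟨i, rfl⟩ := hx; exact h i
  | zero => exact inner_zero_left _
  | add x y _ _ hx hy => rw [inner_add_left, hx, hy, add_zero]
  | smul c x _ hx => rw [inner_smul_left, hx, mul_zero]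

end AnomalySpace

namespace WilsonGraph

variable {O I E : Type*}

/-- The coordinate of the anomaly space attached to an edge end by a vertex orientation. -/
def endCoord (G : WilsonGraph O I E) (o : G.VOrientation) (h : E × Fin 2) : O ⊕ I × Fin 3 :=
  match G.bd h.1 h.2 with
  | Sum.inl i => Sum.inl i
  | Sum.inr j => Sum.inr (j, o.label h)

theorem endCoord_of_eq_inl {G : WilsonGraph O I E} (o : G.VOrientation) {h : E × Fin 2} {i : O}
    (hi : G.bd h.1 h.2 = Sum.inl i) : G.endCoord o h = Sum.inl i := by
  simp [endCoord, hi]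

theorem endCoord_of_eq_inr {G : WilsonGraph O I E} (o : G.VOrientation) {h : E × Fin 2} {j : I}
    (hj : G.bd h.1 h.2 = Sum.inr j) : G.endCoord o h = Sum.inr (j, o.label h) := by
  simp [endCoord, hj]

theorem endCovector_eq (G : WilsonGraph O I E) (o : G.VOrientation) (h : E × Fin 2)
    (v : AnomalySpace O I) : G.endCovector o h v = v (Sum.inr (G.endCoord o h)) := by
  unfold endCovector endCoord
  cases G.bd h.1 h.2 <;> rfl

/-- At an external vertex of a trivalent graph there is exactly one end of a non-Wilson edge. -/
theorem IsTrivalent.exists_unique_end {G : WilsonGraph O I E} (hG : G.IsTrivalent) (i : O) :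
    ∃ h : E × Fin 2, ∀ h', G.bd h'.1 h'.2 = Sum.inl i ↔ h' = h := by
  -- two of the three edge ends at an external vertex belong to the Wilson line
  have h1 : G.innerValence (Sum.inl i) = 1 :=
    Nat.succ_injective (Nat.succ_injective (hG (Sum.inl i)))
  obtain ⟨h, hh⟩ := Set.ncard_eq_one.1 h1
  exact ⟨h, fun h' => by simpa using Set.ext_iff.1 hh h'⟩

theorem IsTrivalent.endCoord_bijective {G : WilsonGraph O I E} (hG : G.IsTrivalent)
    (o : G.VOrientation) : Function.Bijective (G.endCoord o) := by
  constructor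
  · intro h h' hh
    rcases hb : G.bd h.1 h.2 with i | j
    · rcases hb' : G.bd h'.1 h'.2 with i' | j'
      · rw [endCoord_of_eq_inl o hb, endCoord_of_eq_inl o hb', Sum.inl.injEq] at hh
        obtain ⟨h0, h0'⟩ := hG.exists_unique_end i
        rw [(h0' h).1 hb, (h0' h').1 (hh ▸ hb')]
      · simp [endCoord_of_eq_inl o hb, endCoord_of_eq_inr o hb'] at hh
    · rcases hb' : G.bd h'.1 h'.2 with i' | j'
      · simp [endCoord_of_eq_inr o hb, endCoord_of_eq_inl o hb'] at hh
      · rw [endCoord_of_eq_inr o hb, endCoord_of_eq_inr o hb', Sum.inr.injEq, Prod.mk.injEq] at hh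
        exact (o.bijOn j).injOn hb (hh.1 ▸ hb') hh.2
  · rintro (i | ⟨j, c⟩)
    · obtain ⟨h, hh⟩ := hG.exists_unique_end i
      exact ⟨h, endCoord_of_eq_inl o ((hh h).2 rfl)⟩
    · obtain ⟨h, hh, rfl⟩ := (o.bijOn j).surjOn (Set.mem_univ c)
      exact ⟨h, endCoord_of_eq_inr o hh⟩

/-- The numbering of the coordinates of the anomaly space by `a¹, a², a³` and the edge ends, in the
order in which they appear in the orientation form: the end of an edge precedes its origin. -/
def coordEquiv {G : WilsonGraph O I E} (hG : G.IsTrivalent) (o : G.VOrientation) :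
    Fin 3 ⊕ E × Fin 2 ≃ Fin 3 ⊕ (O ⊕ I × Fin 3) :=
  Equiv.sumCongr (Equiv.refl _)
    ((Equiv.prodCongr (Equiv.refl E) Fin.revPerm).trans
      (Equiv.ofBijective _ (hG.endCoord_bijective o)))

theorem card_add_card_pos [Fintype O] [Fintype I] (G : WilsonGraph O I E) :
    (0 : ℝ) < Fintype.card O + Fintype.card I := by
  have := G.nonempty
  have : 0 < Fintype.card O := Fintype.card_pos
  positivity

theorem linearIndependent_normal [Fintype O] [Fintype I] {G : WilsonGraph O I E}
    {p : AnomalySpace O I} (hp : p ∈ G.anomalyVariety) : LinearIndependent ℝ p.normal := by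
  obtain ⟨ha, -, -, -, hD, hT⟩ := hp
  have hdet := AnomalySpace.det_inner_normal_vertical ha hD hT
  rw [Fintype.linearIndependent_iff]
  intro g hg
  refine congrFun (Matrix.eq_zero_of_vecMul_eq_zero (hdet.trans_ne G.card_add_card_pos.ne') ?_)
  ext j
  have : inner ℝ (∑ i, g i • p.normal i) (p.vertical j) = (0 : ℝ) := by
    rw [hg, inner_zero_left]
  simpa [Matrix.vecMul, dotProduct, sum_inner, inner_smul_left] using this

theorem IsTrivalent.card_ends {G : WilsonGraph O I E} [Fintype O] [Fintype I] [Fintype E]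
    (hG : G.IsTrivalent) (o : G.VOrientation) :
    Fintype.card (E × Fin 2) = Fintype.card O + 3 * Fintype.card I := by
  rw [Fintype.card_congr (Equiv.ofBijective _ (hG.endCoord_bijective o))]
  simp [mul_comm]

variable [Fintype E]

/-- There is an orthonormal basis of the tangent space, indexed by the ends of the non-Wilson
edges. -/
theorem exists_orthonormal_tangent [Fintype O] [Fintype I] {G : WilsonGraph O I E}
    (hG : G.IsTrivalent) (o : G.VOrientation) {p : AnomalySpace O I} (hp : p ∈ G.anomalyVariety) :
    ∃ v : E × Fin 2 → AnomalySpace O I, Orthonormal ℝ v ∧ (∀ h, p.IsTangent (v h)) ∧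
      ∀ w, p.IsTangent w → w ∈ Submodule.span ℝ (Set.range v) := by
  have h1 : Module.finrank ℝ p.tangentSpace = Fintype.card (E × Fin 2) := by
    have := Submodule.finrank_add_finrank_orthogonal (Submodule.span ℝ (Set.range p.normal))
    rw [finrank_span_eq_card (linearIndependent_normal hp), finrank_euclideanSpace,
      ← Fintype.card_congr (coordEquiv hG o), Fintype.card_sum] at this
    exact Nat.add_left_cancel this
  let b := (stdOrthonormalBasis ℝ p.tangentSpace).reindex
    ((finCongr h1).trans (Fintype.equivFin (E × Fin 2)).symm)
  refine ⟨fun h => b h, b.orthonormal.comp_linearIsometry p.tangentSpace.subtypeₗᵢ,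
    fun h => AnomalySpace.mem_tangentSpace.1 (b h).2, fun w hw => ?_⟩
  have hw' := b.toBasis.mem_span ⟨w, AnomalySpace.mem_tangentSpace.2 hw⟩
  have := Submodule.mem_map_of_mem (f := p.tangentSpace.subtype) hw'
  rw [Submodule.map_span, ← Set.range_comp] at this
  simpa [Function.comp_def] using this

variable [DecidableEq E]

theorem orientationForm_eq_det {G : WilsonGraph O I E} (hG : G.IsTrivalent) (o : G.VOrientation)
    (p : AnomalySpace O I) (v : E × Fin 2 → AnomalySpace O I) :
    G.orientationForm o p v =
      (Matrix.of fun r c => (Sum.elim p.vertical v c) (coordEquiv hG o r)).det := by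
  unfold orientationForm
  congr 1
  ext r c
  rcases r with k | h
  · rfl
  · simp only [Matrix.of_apply, Sum.elim_inr, endCovector_eq]
    rfl

variable [Fintype O] [Fintype I] [DecidableEq O] [DecidableEq I]

/-- The determinant of the gradients of the constraints and the differentials of the slopes, in the
coordinates of the anomaly space. -/
def slopeDet {G : WilsonGraph O I E} (hG : G.IsTrivalent) (o : G.VOrientation) (k : E → Fin 3)
    (p : AnomalySpace O I) : ℝ :=
  (Matrix.of fun r s => (Sum.elim (fun i => innerSL ℝ (p.normal i)) (G.slopeForm k p) r)
    (EuclideanSpace.single (coordEquiv hG o s) 1)).det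

/-- The gradients and the differentials of the slopes, evaluated on the vertical vectors and a
tangent frame, form a block triangular matrix, which in coordinates is a product of the matrices of
`slopeDet` and of the orientation form. -/
theorem slopeDet_mul_orientationForm {G : WilsonGraph O I E} (hG : G.IsTrivalent)
    (o : G.VOrientation) (k : E → Fin 3) {p : AnomalySpace O I} (hp : p ∈ G.anomalyVariety)
    {v : E × Fin 2 → AnomalySpace O I} (hv : ∀ h, p.IsTangent (v h)) :
    slopeDet hG o k p * G.orientationForm o p v =
      (Fintype.card O + Fintype.card I) * (Matrix.of fun r s => G.slopeForm k p r (v s)).det := by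
  obtain ⟨ha, -, -, -, hD, hT⟩ := hp
  rw [orientationForm_eq_det hG, slopeDet, ← Matrix.det_mul, ← Matrix.of_apply_eq_mul,
    ← AnomalySpace.det_inner_normal_vertical ha hD hT, ← Matrix.det_fromBlocks_zero₁₂ _
    (Matrix.of fun r s => G.slopeForm k p r (p.vertical s))]
  congr 1
  ext (i | r) (j | s)
  · rfl
  · exact (p.isTangent_iff (v s)).1 (hv s) i
  · rfl
  · rfl

/-- The determinant of the coordinates of the gradients and an orthonormal tangent frame has the
square `gramDet`; multiplied by the orientation form it gives the determinant of the pairing of the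
gradients with the vertical vectors. -/
theorem gramDet_mul_sq_orientationForm {G : WilsonGraph O I E} (hG : G.IsTrivalent)
    (o : G.VOrientation) {p : AnomalySpace O I} (hp : p ∈ G.anomalyVariety)
    {v : E × Fin 2 → AnomalySpace O I} (hv : ∀ h, p.IsTangent (v h)) (hv' : Orthonormal ℝ v) :
    p.gramDet * G.orientationForm o p v ^ 2 = (Fintype.card O + Fintype.card I : ℝ) ^ 2 := by
  obtain ⟨ha, -, -, -, hD, hT⟩ := hp
  have h := Matrix.of_apply_eq_mul (coordEquiv hG o)
    (fun r => innerSL ℝ (Sum.elim p.normal v r)) (Sum.elim p.vertical v)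
  have h2 := Matrix.of_apply_eq_mul (coordEquiv hG o)
    (fun r => innerSL ℝ (Sum.elim p.normal v r)) (Sum.elim p.normal v)
  have hvv : ∀ r s, inner ℝ (v r) (v s) = if r = s then (1 : ℝ) else 0 :=
    orthonormal_iff_ite.1 hv'
  have hn := fun s => (p.isTangent_iff (v s)).1 (hv s)
  set B : Matrix (Fin 3 ⊕ E × Fin 2) (Fin 3 ⊕ E × Fin 2) ℝ := Matrix.of fun r s =>
    innerSL ℝ (Sum.elim p.normal v r) (EuclideanSpace.single (coordEquiv hG o s) 1) with hB
  have e1 : B.det * G.orientationForm o p v = Fintype.card O + Fintype.card I := by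
    rw [orientationForm_eq_det hG]
    rw [← Matrix.det_mul, ← h, ← AnomalySpace.det_inner_normal_vertical ha hD hT,
      ← mul_one (Matrix.of fun i j => inner ℝ (p.normal i) (p.vertical j)).det,
      ← Matrix.det_one (n := E × Fin 2),
      ← Matrix.det_fromBlocks_zero₁₂ _ (Matrix.of fun r s => inner ℝ (v r) (p.vertical s))]
    congr 1
    ext (i | r) (j | s)
    · rfl
    · exact hn s i
    · rfl
    · exact hvv r s
  have e2 : B.det * B.det = p.gramDet := by
    have hBt : (Matrix.of fun r c => Sum.elim p.normal v c (coordEquiv hG o r)) = B.transpose := by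
      ext r c
      simp [hB, EuclideanSpace.inner_single_right]
    rw [hBt] at h2
    nth_rw 2 [← Matrix.det_transpose]
    rw [← Matrix.det_mul, ← h2, AnomalySpace.gramDet,
      ← mul_one (Matrix.of fun i j => inner ℝ (p.normal i) (p.normal j)).det,
      ← Matrix.det_one (n := E × Fin 2),
      ← Matrix.det_fromBlocks_zero₁₂ _ 0]
    congr 1
    ext (i | r) (j | s)
    · rfl
    · exact hn s i
    · exact (real_inner_comm _ _).trans (hn r j)
    · exact hvv r s
  rw [← e1, ← e2]
  ring

theorem gramDet_pos {G : WilsonGraph O I E} (hG : G.IsTrivalent) (o : G.VOrientation)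
    {p : AnomalySpace O I} (hp : p ∈ G.anomalyVariety) : 0 < p.gramDet := by
  obtain ⟨v, hv, ht, -⟩ := exists_orthonormal_tangent hG o hp
  have e2 := gramDet_mul_sq_orientationForm hG o hp ht hv
  by_contra hneg
  have := mul_nonpos_of_nonpos_of_nonneg (not_lt.1 hneg) (sq_nonneg (G.orientationForm o p v))
  rw [e2] at this
  have := G.card_add_card_pos
  exact absurd ‹_ ≤ _› (not_le.2 (by positivity))

theorem exists_isPositiveFrame {G : WilsonGraph O I E} (hG : G.IsTrivalent)
    (o : G.VOrientation) {p : AnomalySpace O I} (hp : p ∈ G.anomalyVariety) :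
    ∃ v, G.IsPositiveFrame o p v := by
  obtain ⟨v, hv, ht, -⟩ := exists_orthonormal_tangent hG o hp
  have h0 : G.orientationForm o p v ≠ 0 := fun h => by
    have := gramDet_mul_sq_orientationForm hG o hp ht hv
    rw [h] at this
    exact pow_ne_zero 2 G.card_add_card_pos.ne' (by simpa using this.symm)
  rcases h0.lt_or_gt with hneg | hpos
  · obtain ⟨h, -⟩ := hG.exists_unique_end G.nonempty.some
    -- reversing one vector of the frame changes its orientation
    let c : E × Fin 2 → ℝ := fun h' => if h' = h then -1 else 1
    have hc : ∀ h', c h' * c h' = 1 := fun h' => by by_cases hh : h' = h <;> simp [c, hh]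
    refine ⟨fun h' => c h' • v h', ?_, fun h' => ?_, ?_⟩
    · rw [orthonormal_iff_ite] at hv ⊢
      intro r s
      rw [inner_smul_left, inner_smul_right, hv r s]
      by_cases hrs : r = s
      · simp [hrs, hc]
      · simp [hrs]
    · exact AnomalySpace.mem_tangentSpace.1
        (Submodule.smul_mem _ _ (AnomalySpace.mem_tangentSpace.2 (ht h')))
    · have e : G.orientationForm o p (fun h' => c h' • v h') = -G.orientationForm o p v := by
        have hprod : ∏ r, Sum.elim (fun _ : Fin 3 => (1 : ℝ)) c r = -1 := by
          simp [c, Finset.prod_ite_eq']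
        rw [orientationForm_eq_det hG, orientationForm_eq_det hG, ← neg_one_mul, ← hprod,
          ← Matrix.det_mul_row]
        congr 1
        ext r (i | s)
        · simp
        · simp
      rw [e]
      linarith
  · exact ⟨v, hv, ht, hpos⟩

/-- The density of the anomaly form with respect to the Riemannian volume, in coordinates and
without reference to a frame. -/
theorem anomalyDensity_eq {G : WilsonGraph O I E} (hG : G.IsTrivalent) (o : G.VOrientation)
    {k : E → Fin 3} {p : AnomalySpace O I} (hp : p ∈ G.anomalyVariety)
    (hk : ∀ e, G.edgeVector p e (k e) ≠ 0) :
    G.anomalyDensity o p = (∏ e, G.edgeFactor k p e) * slopeDet hG o k p / √p.gramDet := by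
  have hex := exists_isPositiveFrame hG o hp
  obtain rfl : ‹DecidableEq E› = fun a b => Classical.propDecidable (a = b) :=
    Subsingleton.elim _ _
  classical
  rw [anomalyDensity, dif_pos hex]
  obtain ⟨hv, ht, hpos⟩ := hex.choose_spec
  rw [anomalyForm, wedgeTwoForms_eq_det (f := fun h w => G.slopeForm k p h w)
    fun e x y => edgeForm_eq_slopeForm G (hk e) x y]
  have e1 := slopeDet_mul_orientationForm hG o k hp ht
  have e2 := gramDet_mul_sq_orientationForm hG o hp ht hv
  set w := G.orientationForm o p hex.choose
  have hN := G.card_add_card_pos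
  have hgpos := gramDet_pos hG o hp
  have e3 : √p.gramDet * w = Fintype.card O + Fintype.card I := by
    rw [← sq_eq_sq₀ (by positivity) hN.le, mul_pow, Real.sq_sqrt hgpos.le, e2]
  have hs : 0 < √p.gramDet := Real.sqrt_pos.2 hgpos
  rw [mul_div_assoc]
  congr 1
  rw [eq_div_iff hs.ne']
  have : w ≠ 0 := hpos.ne'
  apply mul_left_cancel₀ this
  rw [← e3] at e1
  linear_combination -e1

/-- In absolute value, the density may be computed with any orthonormal tangent frame. -/
theorem abs_anomalyDensity_eq {G : WilsonGraph O I E} (hG : G.IsTrivalent) (o : G.VOrientation)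
    {k : E → Fin 3} {p : AnomalySpace O I} (hp : p ∈ G.anomalyVariety)
    (hk : ∀ e, G.edgeVector p e (k e) ≠ 0) {v : E × Fin 2 → AnomalySpace O I}
    (hv : Orthonormal ℝ v) (ht : ∀ h, p.IsTangent (v h)) :
    |G.anomalyDensity o p| =
      |∏ e, G.edgeFactor k p e| * |(Matrix.of fun r s => G.slopeForm k p r (v s)).det| := by
  rw [anomalyDensity_eq hG o hp hk]
  have e1 := slopeDet_mul_orientationForm hG o k hp ht
  have e2 := gramDet_mul_sq_orientationForm hG o hp ht hv
  have hN := G.card_add_card_pos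
  set w := G.orientationForm o p v
  have e3 : √p.gramDet * |w| = Fintype.card O + Fintype.card I := by
    rw [← Real.sqrt_sq_eq_abs, mul_comm, ← Real.sqrt_mul (sq_nonneg _), mul_comm, e2,
      Real.sqrt_sq hN.le]
  have hs : √p.gramDet ≠ 0 := fun h => by rw [h, zero_mul] at e3; exact hN.ne e3
  have hw : |w| ≠ 0 := fun h => by rw [h, mul_zero] at e3; exact hN.ne e3
  have e4 : |slopeDet hG o k p| * |w| = √p.gramDet * |w| *
      |(Matrix.of fun r s => G.slopeForm k p r (v s)).det| := by
    rw [e3, ← abs_mul, e1, abs_mul, abs_of_pos hN]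
  rw [abs_div, abs_mul, abs_of_nonneg (Real.sqrt_nonneg _), mul_div_assoc]
  congr 1
  rw [div_eq_iff hs]
  apply mul_right_cancel₀ hw
  linear_combination e4

end WilsonGraph
end

noncomputable section

/-! ### Regularity of the anomaly variety and of the density -/

open Topology

namespace AnomalySpace

variable {O I : Type*} [Fintype O] [Fintype I]

theorem continuous_a : Continuous (a : AnomalySpace O I → _) := aL.continuous

theorem continuous_eta (i : O) : Continuous fun p : AnomalySpace O I => p.eta i :=
  (etaL i).continuous

theorem continuous_om (j : I) : Continuous fun p : AnomalySpace O I => p.om j :=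
  (omL j).continuous

theorem continuous_normal (i : Fin 3) : Continuous fun p : AnomalySpace O I => p.normal i := by
  have h1 : ∀ k : Fin 3, Continuous fun p : AnomalySpace O I => p.a k := fun k =>
    (EuclideanSpace.proj (𝕜 := ℝ) k).continuous.comp continuous_a
  have h2 : ∀ (j : I) (k : Fin 3), Continuous fun p : AnomalySpace O I => p.om j k := fun j k =>
    (EuclideanSpace.proj (𝕜 := ℝ) k).continuous.comp (continuous_om j)
  have h3 := continuous_eta (O := O) (I := I)
  fin_cases i
  · refine (PiLp.continuous_toLp 2 _).comp (continuous_pi ?_)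
    rintro (k | _)
    · exact h1 k
    · exact continuous_const
  · refine (PiLp.continuous_toLp 2 _).comp (continuous_pi ?_)
    rintro (k | i | ⟨j, k⟩)
    · exact continuous_const
    · exact h3 i
    · exact h2 j k
  · refine (PiLp.continuous_toLp 2 _).comp (continuous_pi ?_)
    rintro (k | i | ⟨j, k⟩)
    · have : (fun p : AnomalySpace O I => (∑ j, p.om j) k) = fun p => ∑ j, p.om j k := by
        ext p
        simp
      exact this ▸ continuous_finsetSum _ fun j _ => h2 j k
    · exact continuous_const
    · exact h1 k

theorem continuous_gramDet : Continuous (gramDet : AnomalySpace O I → ℝ) :=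
  Continuous.matrix_det (continuous_matrix fun i j =>
    show Continuous fun p : AnomalySpace O I => (inner ℝ (p.normal i) (p.normal j) : ℝ) from
      Continuous.inner (E := AnomalySpace O I) (continuous_normal i) (continuous_normal j))

/-- The constraints defining the anomaly variety, the first two of them halved. -/
def constraint (p : AnomalySpace O I) : Fin 3 → ℝ :=
  ![1 / 2 * inner ℝ p.a p.a,
    1 / 2 * (∑ i, p.eta i * p.eta i + ∑ j, inner ℝ (p.om j) (p.om j)),
    ∑ i, p.eta i + ∑ j, inner ℝ (p.om j) p.a]

theorem hasStrictFDerivAt_constraint (p : AnomalySpace O I) :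
    HasStrictFDerivAt constraint (ContinuousLinearMap.pi fun i => innerSL ℝ (p.normal i)) p := by
  have ha : HasStrictFDerivAt (fun q : AnomalySpace O I => q.a) aL p := aL.hasStrictFDerivAt
  have he : ∀ i, HasStrictFDerivAt (fun q : AnomalySpace O I => q.eta i) (etaL i) p :=
    fun i => (etaL i).hasStrictFDerivAt
  have ho : ∀ j, HasStrictFDerivAt (fun q : AnomalySpace O I => q.om j) (omL j) p :=
    fun j => (omL j).hasStrictFDerivAt
  rw [hasStrictFDerivAt_pi']
  intro i
  fin_cases i
  · refine ((ha.inner ℝ ha).const_mul (1 / 2)).congr_fderiv ?_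
    ext w
    refine Eq.trans ?_ (inner_radial p w).symm
    simp [fderivInnerCLM_apply, real_inner_comm]
    ring
  · refine (((HasStrictFDerivAt.fun_sum fun i _ => (he i).mul (he i)).add
      (HasStrictFDerivAt.fun_sum fun j _ => (ho j).inner ℝ (ho j))).const_mul
        (1 / 2)).congr_fderiv ?_
    ext w
    refine Eq.trans ?_ (inner_dilatation p w).symm
    simp [fderivInnerCLM_apply]
    simp only [real_inner_comm (p.om _), ← two_mul, ← Finset.mul_sum]
    ring
  · refine ((HasStrictFDerivAt.fun_sum fun i _ => he i).add
      (HasStrictFDerivAt.fun_sum fun j _ => (ho j).inner ℝ ha)).congr_fderiv ?_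
    ext w
    refine Eq.trans ?_ (inner_normal_two p w).symm
    simp [fderivInnerCLM_apply]
    exact Finset.sum_congr rfl fun j _ => add_comm _ _

end AnomalySpace

namespace WilsonGraph

variable {O I E : Type*} [Fintype O] [Fintype I]

theorem measurableSet_anomalyVariety (G : WilsonGraph O I E) : MeasurableSet G.anomalyVariety := by
  have h0 := AnomalySpace.continuous_a (O := O) (I := I)
  have h1 := AnomalySpace.continuous_eta (O := O) (I := I)
  have h2 := AnomalySpace.continuous_om (O := O) (I := I)
  refine MeasurableSet.inter (isClosed_eq h0.norm continuous_const).measurableSet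
    (MeasurableSet.inter ?_ (MeasurableSet.inter ?_ (MeasurableSet.inter ?_
      (MeasurableSet.inter ?_ ?_))))
  · refine MeasurableSet.congr (s := ⋃ v : O, ⋂ (k : ℕ) (l : ℕ) (_ : k < l)
      (_ : l < Fintype.card O),
        {p : AnomalySpace O I | p.eta ((G.next ^ k) v) < p.eta ((G.next ^ l) v)}) ?_ ?_
    · exact MeasurableSet.iUnion fun v => MeasurableSet.iInter fun k =>
        MeasurableSet.iInter fun l => MeasurableSet.iInter fun _ => MeasurableSet.iInter fun _ =>
          (isOpen_lt (h1 _) (h1 _)).measurableSet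
    · ext p
      simp only [Set.mem_iUnion, Set.mem_iInter]
      rfl
  · refine MeasurableSet.congr (s := ⋂ (i : I) (j : I) (_ : i ≠ j),
      {p : AnomalySpace O I | p.om i ≠ p.om j}) ?_ ?_
    · exact MeasurableSet.iInter fun i => MeasurableSet.iInter fun j =>
        MeasurableSet.iInter fun _ => (isOpen_ne_fun (h2 _) (h2 _)).measurableSet
    · ext p
      simp only [Set.mem_iInter]
      rfl
  · refine MeasurableSet.congr (s := ⋂ (i : O) (j : I),
      {p : AnomalySpace O I | p.eta i • p.a ≠ p.om j}) ?_ ?_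
    · exact MeasurableSet.iInter fun i => MeasurableSet.iInter fun j =>
        (isOpen_ne_fun ((h1 i).smul h0) (h2 _)).measurableSet
    · ext p
      simp only [Set.mem_iInter]
      rfl
  · exact (isClosed_eq (by fun_prop) continuous_const).measurableSet
  · exact (isClosed_eq (by fun_prop) continuous_const).measurableSet

/-- Different vertices are placed at different points. -/
theorem pos_injective (G : WilsonGraph O I E) {p : AnomalySpace O I} (hp : p ∈ G.anomalyVariety) :
    Function.Injective p.pos := by
  obtain ⟨ha, ⟨v, hv⟩, hI, hOI, -, -⟩ := hp
  have ha0 : p.a ≠ 0 := fun h => by simp [h] at ha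
  have hc : G.next.IsCycleOn (Finset.univ : Finset O) := by simpa using G.isCycleOn
  have heta : Function.Injective p.eta := by
    intro i i' h
    obtain ⟨k, hk, rfl⟩ := hc.exists_pow_eq (Finset.mem_univ v) (Finset.mem_univ i)
    obtain ⟨l, hl, rfl⟩ := hc.exists_pow_eq (Finset.mem_univ v) (Finset.mem_univ i')
    rcases lt_trichotomy k l with hkl | rfl | hkl
    · exact absurd h (hv k l hkl hl).ne
    · rfl
    · exact absurd h (hv l k hkl hk).ne'
  rintro (i | j) (i' | j') h
  · exact congrArg _ (heta (smul_left_injective ℝ ha0 h))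
  · exact absurd h (hOI i j')
  · exact absurd h.symm (hOI i' j)
  · by_contra hne
    exact hI j j' (fun h' => hne (congrArg _ h')) h

theorem edgeVector_ne_zero (G : WilsonGraph O I E) (hL : ∀ e, G.bd e 0 ≠ G.bd e 1)
    {p : AnomalySpace O I} (hp : p ∈ G.anomalyVariety) (e : E) : G.edgeVector p e ≠ 0 :=
  sub_ne_zero.2 fun h => hL e (G.pos_injective hp h).symm

/-- The part of the anomaly variety on which the edge vectors have their largest components in given
places. -/
def chartVariety (G : WilsonGraph O I E) (k : E → Fin 3) : Set (AnomalySpace O I) :=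
  {p | p ∈ G.anomalyVariety ∧ ∀ e j, |G.edgeVector p e j| ≤ |G.edgeVector p e (k e)|}

theorem continuous_edgeVector_apply (G : WilsonGraph O I E) (e : E) (j : Fin 3) :
    Continuous fun p => G.edgeVector p e j :=
  (EuclideanSpace.proj (𝕜 := ℝ) j).continuous.comp (G.continuous_edgeVector e)

theorem edgeVector_apply_ne_zero (G : WilsonGraph O I E) (hL : ∀ e, G.bd e 0 ≠ G.bd e 1)
    {k : E → Fin 3} {p : AnomalySpace O I} (hp : p ∈ G.chartVariety k) (e : E) :
    G.edgeVector p e (k e) ≠ 0 := fun h =>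
  G.edgeVector_ne_zero hL hp.1 e (by
    ext j
    simpa [h] using hp.2 e j)

theorem iUnion_chartVariety (G : WilsonGraph O I E) :
    ⋃ k, G.chartVariety k = G.anomalyVariety := by
  refine Set.Subset.antisymm (Set.iUnion_subset fun k p hp => hp.1) fun p hp => ?_
  have h : ∀ e, ∃ k : Fin 3, ∀ j, |G.edgeVector p e j| ≤ |G.edgeVector p e k| := fun e => by
    obtain ⟨k, -, hk⟩ := Finset.exists_max_image Finset.univ (fun j => |G.edgeVector p e j|)
      Finset.univ_nonempty
    exact ⟨k, fun j => hk j (Finset.mem_univ j)⟩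
  choose k hk using h
  exact Set.mem_iUnion.2 ⟨k, hp, hk⟩

theorem measurableSet_chartVariety [Finite E] (G : WilsonGraph O I E) (k : E → Fin 3) :
    MeasurableSet (G.chartVariety k) := by
  refine G.measurableSet_anomalyVariety.inter (MeasurableSet.congr
    (s := ⋂ (e : E) (j : Fin 3), {p | |G.edgeVector p e j| ≤ |G.edgeVector p e (k e)|}) ?_ ?_)
  · exact MeasurableSet.iInter fun e => MeasurableSet.iInter fun j =>
      (isClosed_le (G.continuous_edgeVector_apply e j).abs
        (G.continuous_edgeVector_apply e (k e)).abs).measurableSet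
  · ext p
    simp only [Set.mem_iInter]
    rfl

theorem continuous_edgeDeriv_apply (G : WilsonGraph O I E) (e : E) (w : AnomalySpace O I)
    (j : Fin 3) : Continuous fun p => G.edgeDeriv p e w j := by
  have h : ∀ x : O ⊕ I, Continuous fun p : AnomalySpace O I => p.posDeriv x w := by
    rintro (i | j)
    · have h1 : Continuous fun p : AnomalySpace O I => p.eta i • w.a :=
        (AnomalySpace.continuous_eta i).smul continuous_const
      have h2 : Continuous fun p : AnomalySpace O I => w.eta i • p.a :=
        (continuous_const (y := w.eta i)).smul AnomalySpace.continuous_a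
      exact h1.add h2
    · exact continuous_const
  exact (EuclideanSpace.proj (𝕜 := ℝ) j).continuous.comp ((h _).sub (h _))

theorem continuousAt_slopeForm_apply (G : WilsonGraph O I E) {k : E → Fin 3}
    {p : AnomalySpace O I} {h : E × Fin 2} (hp : G.edgeVector p h.1 (k h.1) ≠ 0)
    (w : AnomalySpace O I) : ContinuousAt (fun q => G.slopeForm k q h w) p := by
  simp only [slopeForm_apply, slopeDeriv]
  have h1 : ∀ j, Continuous fun q : AnomalySpace O I => (G.edgeVector q h.1 j : ℝ) :=
    G.continuous_edgeVector_apply h.1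
  have h2 : ∀ j, Continuous fun q : AnomalySpace O I => (G.edgeDeriv q h.1 w j : ℝ) :=
    G.continuous_edgeDeriv_apply h.1 w
  have h3 : ∀ i j, Continuous fun q : AnomalySpace O I =>
      (G.edgeVector q h.1 i * G.edgeDeriv q h.1 w j : ℝ) := fun i j => (h1 i).mul (h2 j)
  have h4 : ∀ i j i' j', Continuous fun q : AnomalySpace O I =>
      (G.edgeVector q h.1 i * G.edgeDeriv q h.1 w j -
        G.edgeVector q h.1 i' * G.edgeDeriv q h.1 w j' : ℝ) :=
    fun i j i' j' => (h3 i j).sub (h3 i' j')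
  have h5 : ∀ j, Continuous fun q : AnomalySpace O I => (G.edgeVector q h.1 j ^ 2 : ℝ) :=
    fun j => (h1 j).pow 2
  exact (h4 _ _ _ _).continuousAt.div (h5 _).continuousAt (pow_ne_zero 2 hp)

variable [Fintype E] [DecidableEq E] [DecidableEq O] [DecidableEq I]

theorem continuousAt_slopeDet {G : WilsonGraph O I E} (hG : G.IsTrivalent) (o : G.VOrientation)
    {k : E → Fin 3} {p : AnomalySpace O I} (hp : ∀ e, G.edgeVector p e (k e) ≠ 0) :
    ContinuousAt (slopeDet hG o k) p := by
  have h : ContinuousAt (fun q : AnomalySpace O I => (Matrix.of fun r s =>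
      (Sum.elim (fun i => innerSL ℝ (q.normal i)) (G.slopeForm k q) r)
        (EuclideanSpace.single (coordEquiv hG o s) 1) :
        Matrix (Fin 3 ⊕ E × Fin 2) (Fin 3 ⊕ E × Fin 2) ℝ)) p := by
    refine continuousAt_pi.2 fun r => continuousAt_pi.2 fun s => ?_
    rcases r with i | h
    · exact (Continuous.inner (𝕜 := ℝ) (E := AnomalySpace O I) (AnomalySpace.continuous_normal i)
        continuous_const).continuousAt
    · exact G.continuousAt_slopeForm_apply (hp h.1) _
  exact (Continuous.matrix_det continuous_id).continuousAt.comp h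

theorem continuousOn_anomalyDensity {G : WilsonGraph O I E} (hG : G.IsTrivalent)
    (o : G.VOrientation) (hL : ∀ e, G.bd e 0 ≠ G.bd e 1) :
    ContinuousOn (G.anomalyDensity o) G.anomalyVariety := by
  intro p hp
  obtain ⟨k, hk⟩ := Set.mem_iUnion.1 (G.iUnion_chartVariety.symm ▸ hp)
  have hpk := G.edgeVector_apply_ne_zero hL hk
  have hev : ∀ᶠ q in 𝓝 p, ∀ e, G.edgeVector q e (k e) ≠ 0 :=
    Filter.eventually_all.2 fun e =>
      (G.continuous_edgeVector_apply e (k e)).continuousAt.eventually_ne (hpk e)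
  have hc : ContinuousAt
      (fun q => (∏ e, G.edgeFactor k q e) * slopeDet hG o k q / √q.gramDet) p := by
    refine ContinuousAt.div (ContinuousAt.mul ?_ (continuousAt_slopeDet hG o hpk))
      AnomalySpace.continuous_gramDet.sqrt.continuousAt (Real.sqrt_pos.2 (gramDet_pos hG o hp)).ne'
    refine tendsto_finsetProd _ fun e _ => ?_
    refine ContinuousAt.mul continuousAt_const (ContinuousAt.pow (ContinuousAt.div
      (G.continuous_edgeVector_apply e (k e)).continuousAt
      (G.continuous_edgeVector e).norm.continuousAt ?_) 3)
    exact norm_ne_zero_iff.2 (G.edgeVector_ne_zero hL hp e)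
  refine hc.continuousWithinAt.congr_of_eventuallyEq ?_ (anomalyDensity_eq hG o hp hpk)
  filter_upwards [mem_nhdsWithin_of_mem_nhds hev, self_mem_nhdsWithin] with q hq hqS
  exact anomalyDensity_eq hG o hqS hq

end WilsonGraph
end

noncomputable section

/-! ### Fibres of the slope map -/

open Topology

namespace AnomalySpace

variable {O I : Type*}

/-- The image of a configuration under the rescaling of `a` by `lam`, the dilatation by `s` and a
translation along `a`: the points `x` in `ℝ³` are moved to `s x + t lam a`. -/
def move (lam s t : ℝ) (p : AnomalySpace O I) : AnomalySpace O I :=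
  WithLp.toLp 2 (Sum.elim (fun k => lam * p.a k)
    (Sum.elim (fun i => s * p.eta i / lam + t) fun jk => s * p.om jk.1 jk.2 + t * lam * p.a jk.2))

theorem pos_move {lam : ℝ} (hl : lam ≠ 0) (s t : ℝ) (p : AnomalySpace O I) (x : O ⊕ I) :
    (p.move lam s t).pos x = s • p.pos x + (t * lam) • p.a := by
  rcases x with i | j
  · ext k
    have h : (p.move lam s t).pos (Sum.inl i) k = (s * p.eta i / lam + t) * (lam * p.a k) := rfl
    rw [h]
    simp [pos]
    field_simp
  · ext k
    rfl

theorem move_injective {lam s : ℝ} (hl : lam ≠ 0) (hs : s ≠ 0) (t : ℝ) :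
    Function.Injective (move lam s t : AnomalySpace O I → AnomalySpace O I) := by
  intro p q h
  have ha : ∀ k, p.a k = q.a k := fun k =>
    mul_left_cancel₀ hl (congrArg (fun r : AnomalySpace O I => r (Sum.inl k)) h)
  have he : ∀ i, p.eta i = q.eta i := fun i => by
    have h1 : s * p.eta i / lam + t = s * q.eta i / lam + t :=
      congrArg (fun r : AnomalySpace O I => r (Sum.inr (Sum.inl i))) h
    rw [add_left_inj, div_left_inj' hl] at h1
    exact mul_left_cancel₀ hs h1
  have ho : ∀ j k, p.om j k = q.om j k := fun j k => by
    have h1 : s * p.om j k + t * lam * p.a k = s * q.om j k + t * lam * q.a k :=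
      congrArg (fun r : AnomalySpace O I => r (Sum.inr (Sum.inr (j, k)))) h
    rw [ha k, add_left_inj] at h1
    exact mul_left_cancel₀ hs h1
  ext (k | i | ⟨j, k⟩)
  · exact ha k
  · exact he i
  · exact ho j k

end AnomalySpace

namespace WilsonGraph

open MvPolynomial

variable {O I E : Type*}

/-- The coordinates of the position of a vertex, as polynomials. -/
def posPoly (x : O ⊕ I) (c : Fin 3) : MvPolynomial (Fin 3 ⊕ (O ⊕ I × Fin 3)) ℝ :=
  match x with
  | Sum.inl i => X (Sum.inr (Sum.inl i)) * X (Sum.inl c)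
  | Sum.inr j => X (Sum.inr (Sum.inr (j, c)))

theorem eval_posPoly (p : AnomalySpace O I) (x : O ⊕ I) (c : Fin 3) :
    eval p.ofLp (posPoly x c) = p.pos x c := by
  rcases x with i | j
  · simp [posPoly]
    rfl
  · simp [posPoly]
    rfl

variable [Fintype O] [Fintype I]

/-- Three polynomials which, on the orbit of a point of the anomaly variety under the maps
`AnomalySpace.move lam s t` with `lam` and `s` positive, determine these parameters. -/
def levelPoly : Fin 3 → MvPolynomial (Fin 3 ⊕ (O ⊕ I × Fin 3)) ℝ :=
  ![∑ c, X (Sum.inl c) ^ 2,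
    C (Fintype.card O + Fintype.card I : ℝ) * (∑ c, X (Sum.inl c) ^ 2) *
      (∑ x : O ⊕ I, ∑ c, posPoly x c ^ 2) - (∑ x : O ⊕ I, ∑ c, posPoly x c * X (Sum.inl c)) ^ 2,
    ∑ x : O ⊕ I, ∑ c, posPoly x c * X (Sum.inl c)]

theorem eval_levelPoly_move (G : WilsonGraph O I E) {p : AnomalySpace O I}
    (hp : p ∈ G.anomalyVariety) {lam : ℝ} (hl : lam ≠ 0) (s t : ℝ) (k : Fin 3) :
    eval (p.move lam s t).ofLp (levelPoly k) =
      (![lam ^ 2, (Fintype.card O + Fintype.card I) * lam ^ 2 * s ^ 2,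
        (Fintype.card O + Fintype.card I) * t * lam ^ 2] : Fin 3 → ℝ) k := by
  obtain ⟨ha, -, -, -, hD, hT⟩ := hp
  have haa : ∑ c, p.a c ^ 2 = 1 := by
    rw [← EuclideanSpace.real_norm_sq_eq, ha, one_pow]
  have hQ : ∑ x, ∑ c, p.pos x c ^ 2 = 1 := by
    rw [← hD, Fintype.sum_sum_type]
    congr 1
    · refine Finset.sum_congr rfl fun i _ => ?_
      rw [← EuclideanSpace.real_norm_sq_eq]
      simp [AnomalySpace.pos, norm_smul, ha]
    · refine Finset.sum_congr rfl fun j _ => ?_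
      rw [← EuclideanSpace.real_norm_sq_eq]
      rfl
  have hR : ∑ x, ∑ c, p.pos x c * p.a c = 0 := by
    rw [← hT, Fintype.sum_sum_type]
    congr 1
    · refine Finset.sum_congr rfl fun i _ => ?_
      simp only [AnomalySpace.pos, PiLp.smul_apply, smul_eq_mul, mul_assoc, ← sq,
        ← Finset.mul_sum, haa, mul_one]
    · refine Finset.sum_congr rfl fun j _ => ?_
      simp [PiLp.inner_apply, AnomalySpace.pos, mul_comm]
  have hX : ∀ c : Fin 3, (p.move lam s t).ofLp (Sum.inl c) = lam * p.a c := fun c => rfl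
  have e0 : eval (p.move lam s t).ofLp
      (∑ c : Fin 3, X (Sum.inl c) ^ 2 : MvPolynomial (Fin 3 ⊕ (O ⊕ I × Fin 3)) ℝ) = lam ^ 2 := by
    simp only [map_sum, map_pow, eval_X, hX, mul_pow, ← Finset.mul_sum, haa, mul_one]
  have e1 : eval (p.move lam s t).ofLp (∑ x : O ⊕ I, ∑ c, posPoly x c ^ 2) =
      s ^ 2 + (Fintype.card O + Fintype.card I) * (t * lam) ^ 2 := by
    simp only [map_sum, map_pow, eval_posPoly, AnomalySpace.pos_move hl, PiLp.add_apply,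
      PiLp.smul_apply, smul_eq_mul]
    have h : ∀ x, ∑ c, (s * p.pos x c + t * lam * p.a c) ^ 2 = s ^ 2 * ∑ c, p.pos x c ^ 2 +
        2 * s * (t * lam) * ∑ c, p.pos x c * p.a c + (t * lam) ^ 2 * ∑ c, p.a c ^ 2 := by
      intro x
      simp only [Finset.mul_sum, ← Finset.sum_add_distrib]
      exact Finset.sum_congr rfl fun c _ => by ring
    simp only [h, Finset.sum_add_distrib, ← Finset.mul_sum, hQ, hR, haa]
    simp
    ring
  have e2 : eval (p.move lam s t).ofLp (∑ x : O ⊕ I, ∑ c, posPoly x c * X (Sum.inl c)) =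
      (Fintype.card O + Fintype.card I) * t * lam ^ 2 := by
    simp only [map_sum, map_mul, eval_posPoly, AnomalySpace.pos_move hl, PiLp.add_apply,
      PiLp.smul_apply, smul_eq_mul, eval_X, hX]
    have h : ∀ x, ∑ c, (s * p.pos x c + t * lam * p.a c) * (lam * p.a c) =
        s * lam * ∑ c, p.pos x c * p.a c + t * lam ^ 2 * ∑ c, p.a c ^ 2 := by
      intro x
      simp only [Finset.mul_sum, ← Finset.sum_add_distrib]
      exact Finset.sum_congr rfl fun c _ => by ring
    simp only [h, Finset.sum_add_distrib, ← Finset.mul_sum, hR, haa]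
    simp
    ring
  fin_cases k
  · exact e0
  · simp only [levelPoly, Fin.mk_one, Matrix.cons_val_one, Matrix.cons_val_zero]
    rw [map_sub, map_mul, map_mul, map_pow, e0, e1, e2, eval_C]
    ring
  · exact e2

/-- Almost all fibres of the slope map in a chart of the anomaly variety are finite, with a uniform
bound. The slopes do not change under the maps `AnomalySpace.move`, hence with the level
polynomials they make up as many functions as there are coordinates of the anomaly space. -/
theorem exists_ae_slopeMap_fibre_card_le [Fintype E] {G : WilsonGraph O I E} (hG : G.IsTrivalent)
    (o : G.VOrientation) (hL : ∀ e, G.bd e 0 ≠ G.bd e 1) (k : E → Fin 3) :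
    ∃ D : ℕ, ∀ᵐ y : EuclideanSpace ℝ (E × Fin 2), ∀ t : Finset (AnomalySpace O I),
      (∀ p ∈ t, p ∈ G.chartVariety k ∧ G.slopeMap k p = y) → t.card ≤ D := by
  let edgePoly : E → Fin 3 → MvPolynomial (Fin 3 ⊕ (O ⊕ I × Fin 3)) ℝ := fun e c =>
    posPoly (G.bd e 1) c - posPoly (G.bd e 0) c
  have hN := G.card_add_card_pos
  set N : ℝ := Fintype.card O + Fintype.card I with hNdef
  -- parameters for which `move` takes the anomaly variety to the level set `z` of `levelPoly`
  let lam : (Fin 3 → ℝ) → ℝ := fun z => √(z 0)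
  let s : (Fin 3 → ℝ) → ℝ := fun z => √(z 1 / (N * z 0))
  let t : (Fin 3 → ℝ) → ℝ := fun z => z 2 / (N * z 0)
  have hz : ∀ z : Fin 3 → ℝ, z ∈ Set.pi Set.univ (fun _ => Set.Ioi (0 : ℝ)) → ∀ i, 0 < z i :=
    fun z h i => h i (Set.mem_univ i)
  have hlam : ∀ z ∈ Set.pi Set.univ (fun _ : Fin 3 => Set.Ioi (0 : ℝ)), lam z ≠ 0 := fun z h =>
    (Real.sqrt_pos.2 (hz z h 0)).ne'
  have hs : ∀ z ∈ Set.pi Set.univ (fun _ : Fin 3 => Set.Ioi (0 : ℝ)), s z ≠ 0 := fun z h =>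
    (Real.sqrt_pos.2 (div_pos (hz z h 1) (mul_pos hN (hz z h 0)))).ne'
  have hedge : ∀ z ∈ Set.pi Set.univ (fun _ : Fin 3 => Set.Ioi (0 : ℝ)),
      ∀ (p : AnomalySpace O I) e c, eval (p.move (lam z) (s z) (t z)).ofLp (edgePoly e c) =
        s z * G.edgeVector p e c := by
    intro z h p e c
    simp only [edgePoly, map_sub, eval_posPoly, AnomalySpace.pos_move (hlam z h), edgeVector]
    simp
    ring
  obtain ⟨D, hD⟩ := exists_ae_fibre_card_le (σ := Fin 3 ⊕ (O ⊕ I × Fin 3)) (ι := E × Fin 2)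
    (κ := Fin 3) (X := AnomalySpace O I)
    (n := fun h => edgePoly h.1 (slopeIndex (k h.1) h.2)) (d := fun h => edgePoly h.1 (k h.1))
    (q := levelPoly) (s := fun _ => Set.Ioi (0 : ℝ)) (S := G.chartVariety k)
    (F := fun p => (G.slopeMap k p).ofLp)
    (by rw [Fintype.card_congr (coordEquiv hG o).symm, Fintype.card_sum, add_comm])
    (fun _ => Set.Ioi_infinite 0) (fun z p => (p.move (lam z) (s z) (t z)).ofLp)
    (fun z h => ((WithLp.ofLp_injective 2).comp
      (AnomalySpace.move_injective (hlam z h) (hs z h) _)).injOn)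
    (fun z h p hp i => by
      rw [hedge z h]
      exact mul_ne_zero (hs z h) (G.edgeVector_apply_ne_zero hL hp i.1))
    (fun z h p hp i => by
      rw [hedge z h, hedge z h, mul_div_mul_left _ _ (hs z h)]
      rfl)
    (fun z h p hp i => by
      have h0 := hz z h 0
      have h1 := hz z h 1
      rw [G.eval_levelPoly_move hp.1 (hlam z h)]
      have e0 : lam z ^ 2 = z 0 := Real.sq_sqrt h0.le
      have e1 : s z ^ 2 = z 1 / (N * z 0) := Real.sq_sqrt (by positivity)
      rw [e0, e1, ← hNdef]
      fin_cases i
      · rfl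
      · simp
        field_simp
      · simp [t]
        field_simp)
  refine ⟨D, ?_⟩
  filter_upwards [(PiLp.volume_preserving_ofLp (E × Fin 2)).quasiMeasurePreserving.ae hD]
    with y hy t ht
  exact hy t fun p hp => ⟨(ht p hp).1, congrArg _ (ht p hp).2⟩

/-! ### Absolute convergence -/

theorem abs_edgeFactor_le_one {O I E : Type*} (G : WilsonGraph O I E) (k : E → Fin 3)
    (p : AnomalySpace O I) (e : E) : |G.edgeFactor k p e| ≤ 1 := by
  have h1 : |G.edgeVector p e (k e) / ‖G.edgeVector p e‖| ≤ 1 := by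
    rw [abs_div, abs_norm]
    exact div_le_one_of_le₀ (by simpa using PiLp.norm_apply_le (G.edgeVector p e) (k e))
      (norm_nonneg _)
  have h2 : |1 / (4 * Real.pi)| ≤ 1 := by
    rw [abs_of_pos (by positivity), div_le_one (by positivity)]
    linarith [Real.pi_gt_three]
  rw [edgeFactor, abs_mul, abs_pow]
  exact mul_le_one₀ h2 (by positivity) (pow_le_one₀ (abs_nonneg _) h1)

theorem abs_slopeMap_le_one [Fintype E] (G : WilsonGraph O I E) {k : E → Fin 3}
    {p : AnomalySpace O I} (hp : p ∈ G.chartVariety k) (h : E × Fin 2) :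
    |G.slopeMap k p h| ≤ 1 := by
  have : G.slopeMap k p h =
    G.edgeVector p h.1 (slopeIndex (k h.1) h.2) / G.edgeVector p h.1 (k h.1) := rfl
  rw [this, abs_div]
  exact div_le_one_of_le₀ (hp.2 _ _) (abs_nonneg _)

theorem constraint_eq (G : WilsonGraph O I E) {p q : AnomalySpace O I}
    (hp : p ∈ G.anomalyVariety) (hq : q ∈ G.anomalyVariety) : p.constraint = q.constraint := by
  have h : ∀ r ∈ G.anomalyVariety, AnomalySpace.constraint r = ![1 / 2, 1 / 2, 0] := by
    rintro r ⟨ha, -, -, -, hD, hT⟩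
    simp only [AnomalySpace.constraint, real_inner_self_eq_norm_sq, ha, hT, ← sq, hD]
    norm_num
  rw [h p hp, h q hq]

theorem surjective_inner_normal {G : WilsonGraph O I E} {p : AnomalySpace O I}
    (hp : p ∈ G.anomalyVariety) :
    Function.Surjective (ContinuousLinearMap.pi fun i => innerSL ℝ (p.normal i)) := by
  obtain ⟨ha, -, -, -, hD, hT⟩ := hp
  have hdet := AnomalySpace.det_inner_normal_vertical ha hD hT
  intro z
  obtain ⟨c, rfl⟩ := Matrix.mulVec_surjective_iff_isUnit.2 ((Matrix.isUnit_iff_isUnit_det _).2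
    (isUnit_iff_ne_zero.2 (hdet.trans_ne G.card_add_card_pos.ne'))) z
  refine ⟨∑ j, c j • p.vertical j, ?_⟩
  ext i
  simp [Matrix.mulVec, dotProduct, mul_comm]

/-- Near a point of a chart where it does not vanish, the density of the anomaly form is dominated
by the volume of the image under the slope map. -/
theorem exists_nhds_lintegral_anomalyDensity_le [Fintype E] {G : WilsonGraph O I E}
    (hG : G.IsTrivalent) (o : G.VOrientation) (hL : ∀ e, G.bd e 0 ≠ G.bd e 1) {k : E → Fin 3}
    {p : AnomalySpace O I} (hp : p ∈ G.chartVariety k) (h0 : G.anomalyDensity o p ≠ 0) :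
    ∃ U ∈ 𝓝 p, Set.InjOn (G.slopeMap k) (G.chartVariety k ∩ U) ∧
      ∀ B ⊆ G.chartVariety k ∩ U, MeasurableSet B →
        ∫⁻ x in B, ‖G.anomalyDensity o x‖ₑ
            ∂Measure.euclideanHausdorffMeasure (Fintype.card (E × Fin 2)) ≤
          2 * 2 ^ Fintype.card (E × Fin 2) * volume (G.slopeMap k '' B) := by
  classical
  have hk := G.edgeVector_apply_ne_zero hL hp
  obtain ⟨v, hv, ht, hspan⟩ := exists_orthonormal_tangent hG o hp.1
  obtain ⟨F', hF, hF'⟩ := G.hasStrictFDerivAt_slopeMap hk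
  have habs := abs_anomalyDensity_eq hG o hp.1 hk hv ht
  have hM : (Matrix.of fun r s => F' (v s) r) = Matrix.of fun r s => G.slopeForm k p r (v s) := by
    ext r s
    exact hF' _ _
  have hdet : (Matrix.of fun r s => F' (v s) r).det ≠ 0 := by
    intro h
    rw [← hM, h, abs_zero, mul_zero] at habs
    exact h0 (abs_eq_zero.1 habs)
  obtain ⟨U, hU, hinj, hB⟩ := exists_nhds_injOn_euclideanHausdorffMeasure_le
    (S := G.chartVariety k) hF (AnomalySpace.hasStrictFDerivAt_constraint p)
    (fun x hx y hy => G.constraint_eq hx.1 hy.1)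
    (surjective_inner_normal hp.1) hv
    (fun w hw => hspan w ((p.isTangent_iff w).2 fun i => congrFun hw i)) hdet
  have hcont := (continuousOn_anomalyDensity hG o hL p hp.1).abs
  -- by continuity, the density is at most twice its value at `p` near `p`
  have hev : ∀ᶠ q in 𝓝[G.anomalyVariety] p, |G.anomalyDensity o q| < 2 * |G.anomalyDensity o p| :=
    hcont.eventually_lt_const (by linarith [abs_pos.2 h0])
  obtain ⟨W, hW, hWlt⟩ := mem_nhdsWithin_iff_exists_mem_nhds_inter.1 hev
  refine ⟨U ∩ W, Filter.inter_mem hU hW,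
    hinj.mono (Set.inter_subset_inter_right _ Set.inter_subset_left),
    fun B hBs hBm => ?_⟩
  calc ∫⁻ x in B, ‖G.anomalyDensity o x‖ₑ
        ∂Measure.euclideanHausdorffMeasure (Fintype.card (E × Fin 2))
      ≤ ∫⁻ x in B, ENNReal.ofReal (2 * |G.anomalyDensity o p|)
        ∂Measure.euclideanHausdorffMeasure (Fintype.card (E × Fin 2)) := by
        refine setLIntegral_mono' hBm fun x hx => ?_
        rw [Real.enorm_eq_ofReal_abs]
        have hxW : x ∈ W ∩ G.anomalyVariety := ⟨(hBs hx).2.2, (hBs hx).1.1⟩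
        exact ENNReal.ofReal_le_ofReal (hWlt hxW).le
    _ = ENNReal.ofReal (2 * |G.anomalyDensity o p|) *
        Measure.euclideanHausdorffMeasure (Fintype.card (E × Fin 2)) B := setLIntegral_const _ _
    _ ≤ ENNReal.ofReal (2 * |G.anomalyDensity o p|) * (2 ^ Fintype.card (E × Fin 2) *
        (ENNReal.ofReal |(Matrix.of fun r s => F' (v s) r).det|⁻¹ *
          volume (G.slopeMap k '' B))) := by
        gcongr
        exact hB B fun x hx => ⟨(hBs hx).1, (hBs hx).2.1⟩
    _ = (ENNReal.ofReal (2 * |G.anomalyDensity o p|) *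
          ENNReal.ofReal |(Matrix.of fun r s => F' (v s) r).det|⁻¹) *
        2 ^ Fintype.card (E × Fin 2) * volume (G.slopeMap k '' B) := by ring
    _ ≤ 2 * 2 ^ Fintype.card (E × Fin 2) * volume (G.slopeMap k '' B) := by
        gcongr
        rw [← ENNReal.ofReal_mul (by positivity)]
        refine (ENNReal.ofReal_le_ofReal ?_).trans_eq (ENNReal.ofReal_ofNat 2)
        rw [habs, ← hM, mul_assoc, mul_assoc, mul_inv_cancel₀ (abs_ne_zero.2 hdet), mul_one,
          Finset.abs_prod]
        have := Finset.prod_le_one (s := Finset.univ) (f := fun e => |G.edgeFactor k p e|)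
          (fun e _ => abs_nonneg _) fun e _ => G.abs_edgeFactor_le_one k p e
        linarith

/-- The slope map sends the part of the variety in each chart into a cube, of finite volume, with
almost all fibres uniformly bounded. -/
theorem anomalyConverges_of_forall_bd_ne [Fintype E] {G : WilsonGraph O I E}
    (hG : G.IsTrivalent) (o : G.VOrientation) (hL : ∀ e, G.bd e 0 ≠ G.bd e 1) :
    G.AnomalyConverges o := by
  classical
  have hS := G.measurableSet_anomalyVariety
  have hcont := continuousOn_anomalyDensity hG o hL
  have hmeas : AEStronglyMeasurable (G.anomalyDensity o) G.anomalyVolume :=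
    hcont.aestronglyMeasurable hS
  refine ⟨hmeas, ?_⟩
  rw [HasFiniteIntegral, anomalyVolume, ← hG.card_ends o, ← G.iUnion_chartVariety]
  refine (lintegral_iUnion_le _ _).trans_lt ?_
  rw [tsum_fintype]
  refine ENNReal.sum_lt_top.2 fun k _ => ?_
  obtain ⟨D, hD⟩ := exists_ae_slopeMap_fibre_card_le hG o hL k
  have hbox := PiLp.volume_preserving_ofLp (E × Fin 2)
  have hSk := G.measurableSet_chartVariety k
  refine (lintegral_le_of_fibre_card_le (J := fun x => ‖G.anomalyDensity o x‖ₑ)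
    (F := G.slopeMap k) (C := 2 * 2 ^ Fintype.card (E × Fin 2)) (D := D) (ν := volume)
    (K := WithLp.ofLp ⁻¹' Set.Icc (-1 : E × Fin 2 → ℝ) 1) ?_ hSk ?_
    (fun p hp h0 => exists_nhds_lintegral_anomalyDensity_le hG o hL hp (by simpa using h0)) hD
    (fun p hp => ?_) (hbox.measurable measurableSet_Icc)).trans_lt ?_
  · have h1 : ContinuousOn (G.anomalyDensity o) (G.chartVariety k) :=
      hcont.mono fun p hp => hp.1
    obtain ⟨u, hu, hus⟩ := continuousOn_iff'.1 h1 _ (isOpen_compl_singleton (x := (0 : ℝ)))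
    have h2 : {x | x ∈ G.chartVariety k ∧ ‖G.anomalyDensity o x‖ₑ ≠ 0} =
        u ∩ G.chartVariety k := by
      rw [← hus, Set.inter_comm]
      ext x
      simp
    rw [h2]
    exact hu.measurableSet.inter hSk
  · intro p hp
    obtain ⟨F', hF, -⟩ := G.hasStrictFDerivAt_slopeMap (G.edgeVector_apply_ne_zero hL hp)
    exact hF.hasFDerivAt.continuousAt.continuousWithinAt
  · have h1 := fun h => abs_le.1 (G.abs_slopeMap_le_one hp h)
    exact ⟨fun h => (h1 h).1, fun h => (h1 h).2⟩
  · rw [hbox.measure_preimage measurableSet_Icc.nullMeasurableSet]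
    refine ENNReal.mul_lt_top ?_ (ENNReal.mul_lt_top (ENNReal.natCast_lt_top D)
      isCompact_Icc.measure_lt_top)
    exact ENNReal.mul_lt_top (by simp) (ENNReal.pow_lt_top (by simp))

end WilsonGraph
end

noncomputable section

/-! ### Loops and graphs which are not primitive -/

namespace AnomalySpace

variable {O I : Type*}

open Classical in
/-- The translation along `a` of the points attached to the vertices in `P`. -/
def partialTranslation (P : O ⊕ I → Prop) (p : AnomalySpace O I) : AnomalySpace O I :=
  WithLp.toLp 2 (Sum.elim (fun _ => 0)
    (Sum.elim (fun i => if P (Sum.inl i) then 1 else 0)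
      fun jk => if P (Sum.inr jk.1) then p.a jk.2 else 0))

variable [Fintype O] [Fintype I]

open Classical in
theorem posDeriv_partialTranslation (P : O ⊕ I → Prop) (p : AnomalySpace O I) (x : O ⊕ I) :
    p.posDeriv x (p.partialTranslation P) = if P x then p.a else 0 := by
  rcases x with i | j
  · have h1 : (p.partialTranslation P).a = 0 := rfl
    have h2 : (p.partialTranslation P).eta i = if P (Sum.inl i) then 1 else 0 := rfl
    simp [posDeriv, h1, h2]
  · ext k
    have h : (p.partialTranslation P).om j k = if P (Sum.inr j) then p.a k else 0 := rfl
    by_cases hP : P (Sum.inr j) <;> simp [posDeriv, h, hP]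

theorem posDeriv_translation (p : AnomalySpace O I) (x : O ⊕ I) :
    p.posDeriv x p.translation = p.a := by
  have h : p.translation = p.partialTranslation fun _ => True := by
    ext (k | i | jk) <;> simp [translation, partialTranslation]
  rw [h, posDeriv_partialTranslation, if_pos trivial]

theorem posDeriv_dilatation (p : AnomalySpace O I) (x : O ⊕ I) :
    p.posDeriv x p.dilatation = p.pos x := by
  rcases x with i | j
  · have h1 : p.dilatation.a = 0 := rfl
    have h2 : p.dilatation.eta i = p.eta i := rfl
    simp [posDeriv, pos, h1, h2]
  · rfl

end AnomalySpace

namespace WilsonGraph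

variable {O I E : Type*} [Fintype O] [Fintype I]

/-- The density vanishes if there is a loop, because the form of a loop is zero. -/
theorem anomalyDensity_eq_zero_of_loop [Fintype E] {G : WilsonGraph O I E} (o : G.VOrientation)
    {e : E} (he : G.bd e 0 = G.bd e 1) (p : AnomalySpace O I) : G.anomalyDensity o p = 0 := by
  have h : ∀ v w, G.edgeForm p e v w = 0 := fun v w => by
    have : G.gaussMap e p = 0 := by simp [gaussMap, he, unitVector]
    simp [edgeForm, this, gaussForm]
  classical
  unfold anomalyDensity
  split_ifs with hv
  · rw [anomalyForm, wedgeTwoForms, Finset.sum_eq_zero, mul_zero]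
    intro σ _
    rw [Finset.prod_eq_zero (Finset.mem_univ e) (h _ _), mul_zero]
  · rfl

theorem IsTrivalent.exists_end {O I E : Type*} {G : WilsonGraph O I E} (hG : G.IsTrivalent)
    (o : G.VOrientation) (x : O ⊕ I) : ∃ h : E × Fin 2, G.bd h.1 h.2 = x := by
  rcases x with i | j
  · obtain ⟨h, hh⟩ := hG.exists_unique_end i
    exact ⟨h, (hh h).2 rfl⟩
  · obtain ⟨h, hh, -⟩ := (o.bijOn j).surjOn (Set.mem_univ 0)
    exact ⟨h, hh⟩

/-- If a set of vertices, neither empty nor everything, contains with one end of an edge the other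
one, then its points can be translated along the Wilson line without a change of the slopes; this
is a tangent vector to the fibre of the slope map. -/
theorem exists_isTangent_slopeForm_eq_zero {G : WilsonGraph O I E} (hG : G.IsTrivalent)
    (o : G.VOrientation) (hL : ∀ e, G.bd e 0 ≠ G.bd e 1) {P : O ⊕ I → Prop}
    (hP : ∀ e, P (G.bd e 0) ↔ P (G.bd e 1)) {x₀ x₁ : O ⊕ I} (h₀ : P x₀) (h₁ : ¬ P x₁)
    {p : AnomalySpace O I} (hp : p ∈ G.anomalyVariety) (k : E → Fin 3) :
    ∃ u : AnomalySpace O I, u ≠ 0 ∧ p.IsTangent u ∧ ∀ h, G.slopeForm k p h u = 0 := by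
  classical
  have hinj := G.pos_injective hp
  obtain ⟨ha, -, -, -, hD, hT⟩ := hp
  have hdet := AnomalySpace.det_inner_normal_vertical ha hD hT
  have ha0 : p.a ≠ 0 := fun h => by simp [h] at ha
  -- the component of the partial translation along the radial, dilatation and translation vectors
  obtain ⟨c, hc⟩ := Matrix.mulVec_surjective_iff_isUnit.2 ((Matrix.isUnit_iff_isUnit_det _).2
    (isUnit_iff_ne_zero.2 (hdet.trans_ne G.card_add_card_pos.ne')))
    fun i => inner ℝ (p.normal i) (p.partialTranslation P)
  have hc' : ∀ i, ∑ j, inner ℝ (p.normal i) (p.vertical j) * c j =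
      inner ℝ (p.normal i) (p.partialTranslation P) := fun i => congrFun hc i
  have hc0 : c 0 = 0 := by
    have h := hc' 0
    have e0 : inner ℝ (p.normal 0) (p.vertical 0) = (1 : ℝ) := by
      refine (p.inner_radial _).trans ?_
      exact (real_inner_self_eq_norm_sq p.a).trans (by rw [ha, one_pow])
    have e1 : inner ℝ (p.normal 0) (p.vertical 1) = (0 : ℝ) :=
      (p.inner_radial _).trans (inner_zero_right _)
    have e2 : inner ℝ (p.normal 0) (p.vertical 2) = (0 : ℝ) :=
      (p.inner_radial _).trans (inner_zero_right _)
    have e3 : inner ℝ (p.normal 0) (p.partialTranslation P) = (0 : ℝ) :=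
      (p.inner_radial _).trans (inner_zero_right _)
    simpa [Fin.sum_univ_three, e0, e1, e2, e3] using h
  have hvert : ∑ j, c j • p.vertical j = c 1 • p.dilatation + c 2 • p.translation := by
    rw [Fin.sum_univ_three, hc0, zero_smul, zero_add]
    rfl
  refine ⟨p.partialTranslation P - ∑ j, c j • p.vertical j, ?_, ?_, ?_⟩
  · intro h0
    rw [sub_eq_zero, hvert] at h0
    have key : ∀ x, (if P x then p.a else 0) = c 1 • p.pos x + c 2 • p.a := fun x => by
      have := congrArg (p.posDeriv x) h0
      rwa [p.posDeriv_partialTranslation, map_add, map_smul, map_smul, p.posDeriv_dilatation,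
        p.posDeriv_translation] at this
    by_cases hc1 : c 1 = 0
    · have e0 := key x₀
      have e1 := key x₁
      rw [if_pos h₀, hc1, zero_smul, zero_add] at e0
      rw [if_neg h₁, hc1, zero_smul, zero_add] at e1
      exact ha0 (e0.trans e1.symm)
    · obtain ⟨⟨e, i⟩, he⟩ := hG.exists_end o x₀
      have he' : P (G.bd e 0) ∧ P (G.bd e 1) := by
        have : P (G.bd e i) := by rw [show G.bd e i = x₀ from he]; exact h₀
        fin_cases i
        · exact ⟨this, (hP e).1 this⟩
        · exact ⟨(hP e).2 this, this⟩
      have e0 := key (G.bd e 0)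
      have e1 := key (G.bd e 1)
      rw [if_pos he'.1] at e0
      rw [if_pos he'.2] at e1
      have e2 := add_right_cancel (e0.symm.trans e1)
      exact hL e (hinj (smul_right_injective _ hc1 e2))
  · rw [AnomalySpace.isTangent_iff]
    intro i
    rw [inner_sub_right, ← hc' i, inner_sum, sub_eq_zero]
    exact Finset.sum_congr rfl fun j _ => by rw [inner_smul_right, mul_comm]
  · intro h
    have e1 : G.edgeDeriv p h.1 (p.partialTranslation P) = 0 := by
      rw [edgeDeriv, sub_apply, p.posDeriv_partialTranslation,
        p.posDeriv_partialTranslation, sub_eq_zero]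
      simp only [hP]
    have e2 : G.edgeDeriv p h.1 p.translation = 0 := by
      rw [edgeDeriv, sub_apply, p.posDeriv_translation,
        p.posDeriv_translation, sub_self]
    have e3 : G.edgeDeriv p h.1 p.dilatation = G.edgeVector p h.1 := by
      rw [edgeDeriv, sub_apply, p.posDeriv_dilatation,
        p.posDeriv_dilatation, edgeVector]
    rw [hvert, slopeForm_apply, map_sub, map_add, map_smul, map_smul, e1, e2, e3]
    simp [slopeDeriv]
    ring_nf
    simp

variable [Fintype E]

theorem anomalyDensity_eq_zero_of_not_isPrimitive {G : WilsonGraph O I E} (hG : G.IsTrivalent)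
    (o : G.VOrientation) (hL : ∀ e, G.bd e 0 ≠ G.bd e 1) (hprim : ¬ G.IsPrimitive)
    {p : AnomalySpace O I} (hp : p ∈ G.anomalyVariety) : G.anomalyDensity o p = 0 := by
  classical
  have : Nonempty (O ⊕ I) := ⟨Sum.inl G.nonempty.some⟩
  obtain ⟨x₀, x₁, hx⟩ : ∃ x₀ x₁, ¬ G.minusWilson.Reachable x₀ x₁ := by
    by_contra! h
    exact hprim ((SimpleGraph.connected_iff _).2 ⟨h, this⟩)
  have hadj : ∀ e, G.minusWilson.Adj (G.bd e 0) (G.bd e 1) := fun e =>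
    (SimpleGraph.fromRel_adj _ _ _).2 ⟨hL e, Or.inl ⟨e, rfl, rfl⟩⟩
  obtain ⟨k, hk⟩ := Set.mem_iUnion.1 (G.iUnion_chartVariety.symm ▸ hp)
  obtain ⟨u, hu0, hut, hu⟩ := exists_isTangent_slopeForm_eq_zero hG o hL
    (P := G.minusWilson.Reachable x₀)
    (fun e => ⟨fun h => h.trans (hadj e).reachable, fun h => h.trans (hadj e).reachable.symm⟩)
    (SimpleGraph.Reachable.refl x₀) hx hp k
  obtain ⟨v, hv, ht, hspan⟩ := exists_orthonormal_tangent hG o hp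
  obtain ⟨c, rfl⟩ := (Submodule.mem_span_range_iff_exists_fun ℝ).1 (hspan u hut)
  have hdet : (Matrix.of fun r s => G.slopeForm k p r (v s)).det = 0 := by
    refine Matrix.exists_mulVec_eq_zero_iff.1 ⟨c, fun hc => hu0 (by simp [hc]), ?_⟩
    ext r
    have := hu r
    rw [map_sum] at this
    simpa [Matrix.mulVec, dotProduct, mul_comm] using this
  have := abs_anomalyDensity_eq hG o hp (G.edgeVector_apply_ne_zero hL hk) hv ht
  rwa [hdet, abs_zero, mul_zero, abs_eq_zero] at this

end WilsonGraph

/-! ### The central symmetry -/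

namespace AnomalySpace

variable {O I : Type*}

/-- The sign by which the central symmetry acts on a coordinate. -/
def reflectSign : Fin 3 ⊕ (O ⊕ I × Fin 3) → ℝ :=
  Sum.elim (fun _ => -1) (Sum.elim (fun _ => 1) fun _ => -1)

variable [Fintype O] [Fintype I]

/-- The central symmetry `(a, η, ω) ↦ (-a, η, -ω)`, which moves every point of a configuration in
`ℝ³` to its opposite. -/
def reflect : AnomalySpace O I ≃ₗᵢ[ℝ] AnomalySpace O I :=
  LinearIsometryEquiv.piLpCongrRight 2 (Sum.elim (fun _ => LinearIsometryEquiv.neg ℝ)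
    (Sum.elim (fun _ => LinearIsometryEquiv.refl ℝ ℝ) fun _ => LinearIsometryEquiv.neg ℝ))

theorem reflect_apply (p : AnomalySpace O I) (x) : reflect p x = reflectSign x * p x := by
  rcases x with k | i | jk <;> simp [reflect, reflectSign]

theorem reflect_reflect (p : AnomalySpace O I) : reflect (reflect p) = p := by
  ext (k | i | jk) <;> simp [reflect_apply, reflectSign]

@[simp] theorem a_reflect (p : AnomalySpace O I) : (reflect p).a = -p.a := by
  ext k
  exact (reflect_apply p _).trans (neg_one_mul _)

@[simp] theorem eta_reflect (p : AnomalySpace O I) (i : O) : (reflect p).eta i = p.eta i :=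
  (reflect_apply p _).trans (one_mul _)

@[simp] theorem om_reflect (p : AnomalySpace O I) (j : I) : (reflect p).om j = -p.om j := by
  ext k
  exact (reflect_apply p _).trans (neg_one_mul _)

theorem pos_reflect (p : AnomalySpace O I) (x : O ⊕ I) : (reflect p).pos x = -p.pos x := by
  rcases x with i | j <;> simp [pos]

theorem posDeriv_reflect (p w : AnomalySpace O I) (x : O ⊕ I) :
    (reflect p).posDeriv x (reflect w) = -p.posDeriv x w := by
  rcases x with i | j
  · simp [posDeriv]
    abel
  · simp [posDeriv]

theorem normal_reflect (p : AnomalySpace O I) (i : Fin 3) :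
    (reflect p).normal i = reflect (p.normal i) := by
  ext x
  rw [reflect_apply]
  fin_cases i <;> rcases x with k | i | ⟨j, k⟩ <;>
    simp [normal, radial, dilatation, reflectSign]

theorem gramDet_reflect (p : AnomalySpace O I) : (reflect p).gramDet = p.gramDet := by
  simp only [gramDet, normal_reflect, LinearIsometryEquiv.inner_map_map]

theorem prod_reflectSign :
    ∏ x : Fin 3 ⊕ (O ⊕ I × Fin 3), reflectSign x = (-1) ^ (3 + 3 * Fintype.card I) := by
  simp [reflectSign, pow_add, mul_comm]

end AnomalySpace

namespace WilsonGraph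

open AnomalySpace

variable {O I E : Type*} [Fintype O] [Fintype I]

theorem reflect_mem_anomalyVariety (G : WilsonGraph O I E) {p : AnomalySpace O I}
    (hp : p ∈ G.anomalyVariety) : reflect p ∈ G.anomalyVariety := by
  obtain ⟨ha, hv, hI, hOI, hD, hT⟩ := hp
  refine ⟨by simpa using ha, by simpa using hv, fun i j hij => ?_, fun i j => ?_, ?_, ?_⟩
  · simpa using hI i j hij
  · simpa using hOI i j
  · simpa using hD
  · simpa using hT

theorem edgeVector_reflect (G : WilsonGraph O I E) (p : AnomalySpace O I) (e : E) :
    G.edgeVector (reflect p) e = -G.edgeVector p e := by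
  simp only [edgeVector, pos_reflect]
  abel

theorem edgeFactor_reflect (G : WilsonGraph O I E) (k : E → Fin 3) (p : AnomalySpace O I) (e : E) :
    G.edgeFactor k (reflect p) e = -G.edgeFactor k p e := by
  simp only [edgeFactor, edgeVector_reflect, norm_neg, PiLp.neg_apply]
  ring

theorem slopeForm_reflect (G : WilsonGraph O I E) (k : E → Fin 3) (p w : AnomalySpace O I)
    (h : E × Fin 2) : G.slopeForm k (reflect p) h (reflect w) = G.slopeForm k p h w := by
  have : G.edgeDeriv (reflect p) h.1 (reflect w) = -G.edgeDeriv p h.1 w := by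
    simp only [edgeDeriv, sub_apply, posDeriv_reflect]
    abel
  simp [slopeForm_apply, slopeDeriv, edgeVector_reflect, this]

variable [Fintype E]

theorem slopeDet_reflect [DecidableEq E] [DecidableEq O] [DecidableEq I] {G : WilsonGraph O I E}
    (hG : G.IsTrivalent) (o : G.VOrientation) (k : E → Fin 3) (p : AnomalySpace O I) :
    slopeDet hG o k (reflect p) = (-1) ^ (3 + 3 * Fintype.card I) * slopeDet hG o k p := by
  have hsingle : ∀ x, EuclideanSpace.single x (1 : ℝ) =
      reflectSign x • (reflect (EuclideanSpace.single x 1) : AnomalySpace O I) := by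
    intro x
    ext y
    rw [PiLp.smul_apply, reflect_apply, smul_eq_mul]
    by_cases hxy : y = x
    · subst hxy
      rcases y with k | i | jk <;> simp [reflectSign]
    · simp [hxy]
  rw [← prod_reflectSign (O := O), ← Equiv.prod_comp (coordEquiv hG o), slopeDet, slopeDet,
    ← Matrix.det_mul_row]
  congr 1
  ext r s
  rw [Matrix.of_apply, Matrix.of_apply, Matrix.of_apply]
  refine (congrArg _ (hsingle _)).trans ?_
  rw [map_smul, smul_eq_mul]
  congr 1
  rcases r with i | h
  · simp only [Sum.elim_inl, innerSL_apply_apply, normal_reflect,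
      LinearIsometryEquiv.inner_map_map]
  · exact G.slopeForm_reflect k p _ h

/-- The central symmetry multiplies each edge form by `-1`, and the orientation by `-1` for each of
the coordinates of `a` and `ω`. -/
theorem anomalyDensity_reflect {G : WilsonGraph O I E} (hG : G.IsTrivalent) (o : G.VOrientation)
    (hL : ∀ e, G.bd e 0 ≠ G.bd e 1) {p : AnomalySpace O I} (hp : p ∈ G.anomalyVariety) :
    G.anomalyDensity o (reflect p) =
      (-1) ^ (Fintype.card E + (3 + 3 * Fintype.card I)) * G.anomalyDensity o p := by
  classical
  obtain ⟨k, hk⟩ := Set.mem_iUnion.1 (G.iUnion_chartVariety.symm ▸ hp)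
  have hk0 := G.edgeVector_apply_ne_zero hL hk
  rw [anomalyDensity_eq hG o hp hk0, anomalyDensity_eq hG o (G.reflect_mem_anomalyVariety hp)
    (k := k) fun e => by simpa [edgeVector_reflect] using hk0 e, gramDet_reflect, slopeDet_reflect]
  simp only [edgeFactor_reflect, Finset.prod_neg, Finset.card_univ]
  ring

theorem anomalyDensity_reflect_of_even {G : WilsonGraph O I E} (hG : G.IsTrivalent)
    (o : G.VOrientation) (hL : ∀ e, G.bd e 0 ≠ G.bd e 1) (hdeg : Even G.deg)
    {p : AnomalySpace O I} (hp : p ∈ G.anomalyVariety) :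
    G.anomalyDensity o (reflect p) = -G.anomalyDensity o p := by
  have hcard := hG.card_ends o
  rw [Fintype.card_prod, Fintype.card_fin] at hcard
  have hodd : Odd (Fintype.card E + (3 + 3 * Fintype.card I)) := by
    obtain ⟨r, hr⟩ := hdeg
    unfold deg at hr
    refine ⟨r + 1 + 2 * Fintype.card I, ?_⟩
    omega
  rw [anomalyDensity_reflect hG o hL hp, hodd.neg_one_pow, neg_one_mul]

theorem anomalyCoefficient_eq_zero_of_even {G : WilsonGraph O I E} (hG : G.IsTrivalent)
    (o : G.VOrientation) (hL : ∀ e, G.bd e 0 ≠ G.bd e 1) (hdeg : Even G.deg) :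
    G.anomalyCoefficient o = 0 := by
  have hmp :=
    (reflect (O := O) (I := I)).toIsometryEquiv.measurePreserving_euclideanHausdorffMeasure
      (Fintype.card O + 3 * Fintype.card I)
  have hpre : (reflect (O := O) (I := I)).toIsometryEquiv ⁻¹' G.anomalyVariety =
      G.anomalyVariety := by
    ext p
    refine ⟨fun h => ?_, fun h => G.reflect_mem_anomalyVariety h⟩
    rw [← reflect_reflect p]
    exact G.reflect_mem_anomalyVariety h
  have h := hmp.setIntegral_preimage_emb
    (reflect (O := O) (I := I)).toIsometryEquiv.toHomeomorph.measurableEmbedding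
    (G.anomalyDensity o) G.anomalyVariety
  rw [hpre] at h
  have h2 := setIntegral_congr_fun (μ := Measure.euclideanHausdorffMeasure
    (Fintype.card O + 3 * Fintype.card I)) G.measurableSet_anomalyVariety
    (fun p hp => anomalyDensity_reflect_of_even hG o hL hdeg hp)
  rw [integral_neg] at h2
  have h3 := h2.symm.trans h
  unfold anomalyCoefficient anomalyVolume
  linarith

end WilsonGraph

end

theorem mainTheorem4 {O I E : Type*} [Fintype O] [Fintype I] [Fintype E]
    (G : WilsonGraph O I E) (hG : G.IsTrivalent) (o : G.VOrientation) :
    (¬ G.IsPrimitive → G.AnomalyConverges o ∧ G.anomalyCoefficient o = 0) ∧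
    (G.IsPrimitive → Even G.deg → G.AnomalyConverges o ∧ G.anomalyCoefficient o = 0) := by
  by_cases hL : ∀ e, G.bd e 0 ≠ G.bd e 1
  · have hconv := WilsonGraph.anomalyConverges_of_forall_bd_ne hG o hL
    refine ⟨fun hprim => ⟨hconv, ?_⟩, fun _ hdeg => ⟨hconv, ?_⟩⟩
    · exact setIntegral_eq_zero_of_forall_eq_zero fun p hp =>
        WilsonGraph.anomalyDensity_eq_zero_of_not_isPrimitive hG o hL hprim hp
    · exact WilsonGraph.anomalyCoefficient_eq_zero_of_even hG o hL hdeg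
  · push Not at hL
    obtain ⟨e, he⟩ := hL
    have h0 : G.anomalyDensity o = 0 :=
      funext fun p => WilsonGraph.anomalyDensity_eq_zero_of_loop o he p
    have h : G.AnomalyConverges o ∧ G.anomalyCoefficient o = 0 := by
      rw [WilsonGraph.AnomalyConverges, WilsonGraph.anomalyCoefficient, h0]
      exact ⟨integrable_zero _ _ _, integral_zero _ _⟩
    exact ⟨fun _ => h, fun _ _ => h⟩
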